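/- Let $E$ be a complex Banach lattice, i.e. the complexification of a real Banach lattice $E_{\mathbb R}$, with modulus $|x+iy|=\sup_{\theta}(\cos\theta\,x+\sin\theta\,y)$ and norm $\|z\|=\|\,|z|\,\|$. Let $u\in E_+$ and let $E_u=\{x\in E:\ |x|\le cu\text{ for some }c>0\}$ be the principal ideal generated by $u$, with the gauge norm $\|x\|_{E_u}=\inf\{c>0:\ |x|\le cu\}$. An operator $A:\operatorname{dom}(A)\subseteq E\to E$ is called real if $\operatorname{dom}(A)=\operatorname{dom}(A)\cap E_{\mathbb R}+i\,\operatorname{dom}(A)\cap E_{\mathbb R}$ and $A(\operatorname{dom}(A)\cap E_{\mathbb R})\subseteq E_{\mathbb R}$. Let $(T(t))_{t\ge0}$ be an immediately differentiable $C_0$-semigroup on $E$ (all orbits are differentiable on $(0,\infty)$) with real generator $A$. For every $\kappa\in\mathbb C$ with $|\kappa|<1$ let $B(\kappa):\operatorname{dom}(A)\to E$ be linear and bounded with respect to the graph norm of $A$, with $B(0)=0$, with $B(\kappa)$ real for real $\kappa$, and put $A(\kappa)=A+B(\kappa)$ with domain $\operatorname{dom}(A)$. Suppose that $\kappa\mapsto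 A(\kappa)x$ is holomorphic on the open unit disc for every $x\in\operatorname{dom}(A)$, and that: 1. there are $C\ge1$ and $\alpha>0$ such that $T(t)E\subseteq E_u$ and $\|T(t)\|_{E\to E_u}\le Ct^{-\alpha}$ for all $t\in(0,1]$; 2. for each $\kappa$ there are $q\in(0,1)$ and $t_0>0$ with $\int_0^{t_0}\|B(\kappa)T(s)x\|\,ds\le q\|x\|$ for all $x\in\operatorname{dom}(A)$; 3. for each $\kappa$ there are $C\ge1$ and $\beta\in[0,1)$ such that, for all $t\in(0,1]$ and $x\in E_u$, one has $T(t)x\in E_u$ with $\|T(t)x\|_{E_u}\le C\|x\|_{E_u}$ and, whenever $T(t)x\in\operatorname{dom}(A)$, also $B(\kappa)T(t)x\in E_u$ with $\|B(\kappa)T(t)x\|_{E_u}\le Ct^{-\beta}\|x\|_{E_u}$. Let $\lambda_0\in\sigma(A)\cap\mathbb R$ be a pole of the resolvent $R(\cdot,A)=(\cdot-A)^{-1}$ and an algebraically simple eigenvalue of $A$ (i.e. $\bigcup_m\ker(\lambda_0-A)^m$ is one-dimensional) with an eigenvector $v_0$ satisfying $v_0\ge cu$ for some $c>0$. Let $r>0$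 be such that $[\lambda_0-r,\lambda_0+r]\cap\sigma(A)=\{\lambda_0\}$, and suppose that $$\beta_\kappa:=\sup_{\lambda\in\mathbb R,\ |\lambda-\lambda_0|=r}\|B(\kappa)R(\lambda,A)\|\to0\qquad\text{as }\kappa\to0\text{ in }\mathbb R .$$ Then there exists $\delta\in(0,1]$ such that for every $\kappa\in(-\delta,\delta)$ the operator $A(\kappa)$ has exactly one eigenvalue $\lambda(\kappa)$ in the open interval $(\lambda_0-r,\lambda_0+r)$, this eigenvalue is algebraically simple, and it has an eigenvector $v(\kappa)\in E_u$ with $v(\kappa)\ge\frac c2u$. -/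

import Mathlib

open Filter Topology Set

noncomputable section

/-! ## Complex Banach lattices

A real Banach lattice is a complete normed space `F` over `ℝ` with a lattice order that is
compatible with the vector space structure and whose norm is solid.  A complex Banach lattice is
the complexification `F ⊕ iF`, with modulus `|x + iy| = sup_θ (cos θ • x + sin θ • y)` and norm
`‖z‖ = ‖|z|‖`. -/

/-- The complexification `F ⊕ iF` of a real Banach lattice `F`. -/
@[ext]
structure LatticeCplx (F : Type*) where
  /-- real part -/
  re : F
  /-- imaginary part -/
  im : F

namespace LatticeCplx

section Algebra

variable {F : Type*} [AddCommGroup F]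

instance : Zero (LatticeCplx F) := ⟨⟨0, 0⟩⟩
instance : Add (LatticeCplx F) := ⟨fun z w => ⟨z.re + w.re, z.im + w.im⟩⟩
instance : Neg (LatticeCplx F) := ⟨fun z => ⟨-z.re, -z.im⟩⟩
instance : Sub (LatticeCplx F) := ⟨fun z w => ⟨z.re - w.re, z.im - w.im⟩⟩

@[simp] theorem zero_re : (0 : LatticeCplx F).re = 0 := rfl
@[simp] theorem zero_im : (0 : LatticeCplx F).im = 0 := rfl
@[simp] theorem add_re (z w : LatticeCplx F) : (z + w).re = z.re + w.re := rfl
@[simp] theorem add_im (z w : LatticeCplx F) : (z + w).im = z.im + w.im := rfl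
@[simp] theorem neg_re (z : LatticeCplx F) : (-z).re = -z.re := rfl
@[simp] theorem neg_im (z : LatticeCplx F) : (-z).im = -z.im := rfl
@[simp] theorem sub_re (z w : LatticeCplx F) : (z - w).re = z.re - w.re := rfl
@[simp] theorem sub_im (z w : LatticeCplx F) : (z - w).im = z.im - w.im := rfl

instance : AddCommGroup (LatticeCplx F) where
  add_assoc a b c := by ext <;> simp [add_assoc]
  zero_add a := by ext <;> simp
  add_zero a := by ext <;> simp
  add_comm a b := by ext <;> simp [add_comm]
  neg_add_cancel a := by ext <;> simp
  sub_eq_add_neg a b := by ext <;> simp [sub_eq_add_neg]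
  nsmul := nsmulRec
  zsmul := zsmulRec

variable [Module ℝ F]

instance : SMul ℂ (LatticeCplx F) :=
  ⟨fun a z => ⟨a.re • z.re - a.im • z.im, a.re • z.im + a.im • z.re⟩⟩

@[simp] theorem smul_re (a : ℂ) (z : LatticeCplx F) :
    (a • z).re = a.re • z.re - a.im • z.im := rfl
@[simp] theorem smul_im (a : ℂ) (z : LatticeCplx F) :
    (a • z).im = a.re • z.im + a.im • z.re := rfl

instance : Module ℂ (LatticeCplx F) where
  one_smul z := by ext <;> simp
  mul_smul a b z := by
    ext <;> simp only [smul_re, smul_im, Complex.mul_re, Complex.mul_im] <;> module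
  smul_zero a := by ext <;> simp
  smul_add a z w := by ext <;> simp only [smul_re, smul_im, add_re, add_im] <;> module
  add_smul a b z := by
    ext <;> simp only [smul_re, smul_im, add_re, add_im, Complex.add_re, Complex.add_im] <;> module
  zero_smul z := by ext <;> simp

/-- The inclusion of the real part `F` into its complexification. -/
def ofReal (x : F) : LatticeCplx F := ⟨x, 0⟩

end Algebra

/-- The order of the complexification: `z ≤ w` if and only if `w - z` lies in the positive cone
of the real part. -/
instance {F : Type*} [LE F] : LE (LatticeCplx F) := ⟨fun z w => z.re ≤ w.re ∧ z.im = w.im⟩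

section Modulus

set_option linter.unusedSectionVars false

variable {F : Type*} [NormedAddCommGroup F] [Lattice F] [HasSolidNorm F] [IsOrderedAddMonoid F]
  [NormedSpace ℝ F] [IsOrderedModule ℝ F]

theorem smul_le_smul_abs (a : ℝ) (x : F) : a • x ≤ |a| • |x| := by
  rcases le_total 0 a with ha | ha
  · rw [abs_of_nonneg ha]
    exact smul_le_smul_of_nonneg_left (le_abs_self x) ha
  · rw [abs_of_nonpos ha, ← neg_smul_neg]
    exact smul_le_smul_of_nonneg_left (neg_le_abs x) (neg_nonneg.2 ha)

/-- The vector `Re (e^{-iθ} (x + iy))`. -/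
def rot (x y : F) (θ : ℝ) : F := Real.cos θ • x + Real.sin θ • y

theorem rot_le (x y : F) (θ φ : ℝ) : rot x y θ ≤ rot x y φ + |θ - φ| • (|x| + |y|) := by
  have h1 : |Real.cos θ - Real.cos φ| ≤ |θ - φ| := by
    simpa [Real.dist_eq] using Real.lipschitzWith_cos.dist_le_mul θ φ
  have h2 : |Real.sin θ - Real.sin φ| ≤ |θ - φ| := by
    simpa [Real.dist_eq] using Real.lipschitzWith_sin.dist_le_mul θ φ
  have h3 : (Real.cos θ - Real.cos φ) • x ≤ |θ - φ| • |x| :=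
    (smul_le_smul_abs _ _).trans (smul_le_smul_of_nonneg_right h1 (abs_nonneg x))
  have h4 : (Real.sin θ - Real.sin φ) • y ≤ |θ - φ| • |y| :=
    (smul_le_smul_abs _ _).trans (smul_le_smul_of_nonneg_right h2 (abs_nonneg y))
  have h5 : rot x y θ = rot x y φ +
      ((Real.cos θ - Real.cos φ) • x + (Real.sin θ - Real.sin φ) • y) := by
    simp only [rot]; module
  rw [h5, smul_add]
  exact add_le_add_right (add_le_add h3 h4) _

theorem exists_isLUB_rot [CompleteSpace F] (x y : F) : ∃ m, IsLUB (range (rot x y)) m := by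
  set w : F := |x| + |y| with hw
  have hw0 : 0 ≤ w := add_nonneg (abs_nonneg x) (abs_nonneg y)
  let e : ℕ → ℝ := fun n => 2 * Real.pi / (n + 1)
  have he0 : ∀ n, 0 < e n := fun n => by have := Real.pi_pos; positivity
  let s : ℕ → F := fun n =>
    (Finset.range (n + 1)).sup' Finset.nonempty_range_add_one (fun k => rot x y (k * e n))
  have hub : ∀ n θ, rot x y θ ≤ s n + e n • w := by
    intro n θ
    have hper : Function.Periodic (rot x y) (2 * Real.pi) := fun t => by simp [rot]
    obtain ⟨t, ht, hEq⟩ := hper.exists_mem_Ico₀ (by have := Real.pi_pos; positivity) θ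
    rw [hEq]
    have hk0 : 0 ≤ t / e n := div_nonneg ht.1 (he0 n).le
    have hlo : (⌊t / e n⌋₊ : ℝ) * e n ≤ t := by
      rw [← le_div_iff₀ (he0 n)]; exact Nat.floor_le hk0
    have hhi : t < ((⌊t / e n⌋₊ : ℝ) + 1) * e n := by
      rw [← div_lt_iff₀ (he0 n)]; exact Nat.lt_floor_add_one _
    have hmem : ⌊t / e n⌋₊ ∈ Finset.range (n + 1) := by
      rw [Finset.mem_range, Nat.floor_lt hk0, div_lt_iff₀ (he0 n)]
      have : ((n + 1 : ℕ) : ℝ) * e n = 2 * Real.pi := by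
        simp only [e]; push_cast; field_simp
      rw [this]; exact ht.2
    refine (rot_le x y t (⌊t / e n⌋₊ * e n)).trans (add_le_add ?_ ?_)
    · exact Finset.le_sup' (fun k : ℕ => rot x y (k * e n)) hmem
    · refine smul_le_smul_of_nonneg_right ?_ hw0
      rw [abs_of_nonneg (by linarith)]
      linarith
  have hss : ∀ m n, s m ≤ s n + e n • w := fun m n =>
    Finset.sup'_le _ _ fun k _ => hub n _
  have hdist : ∀ m n N, N ≤ m → N ≤ n → dist (s m) (s n) ≤ e N * ‖w‖ := by
    intro m n N hm hn
    have hmono : ∀ p, N ≤ p → e p ≤ e N := fun p hp => by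
      have := Real.pi_pos
      have : (N : ℝ) ≤ p := by exact_mod_cast hp
      simp only [e]; gcongr
    have h1 : |s m - s n| ≤ e N • w := by
      rw [abs_le', neg_sub]
      refine ⟨sub_le_iff_le_add'.2 ((hss m n).trans ?_), sub_le_iff_le_add'.2 ((hss n m).trans ?_)⟩
      · exact add_le_add_right (smul_le_smul_of_nonneg_right (hmono n hn) hw0) _
      · exact add_le_add_right (smul_le_smul_of_nonneg_right (hmono m hm) hw0) _
    rw [dist_eq_norm]
    calc ‖s m - s n‖ ≤ ‖e N • w‖ := norm_le_norm_of_abs_le_abs (h1.trans (le_abs_self _))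
      _ = e N * ‖w‖ := by rw [norm_smul, Real.norm_of_nonneg (he0 N).le]
  have he : Tendsto e atTop (𝓝 0) := by
    simpa [e, div_eq_mul_inv] using
      (tendsto_one_div_add_atTop_nhds_zero_nat (𝕜 := ℝ)).const_mul (2 * Real.pi)
  have hc : CauchySeq s := cauchySeq_of_le_tendsto_0 (fun N => e N * ‖w‖)
    (fun m n N hm hn => hdist m n N hm hn) (by simpa using he.mul_const ‖w‖)
  obtain ⟨m, hm⟩ := cauchySeq_tendsto_of_complete hc
  refine ⟨m, ?_, ?_⟩
  · rintro _ ⟨θ, rfl⟩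
    have : Tendsto (fun n => s n + e n • w) atTop (𝓝 m) := by
      simpa using hm.add (he.smul_const w)
    exact ge_of_tendsto' this fun n => hub n θ
  · intro b hb
    exact le_of_tendsto' hm fun n => Finset.sup'_le _ _ fun k _ => hb ⟨_, rfl⟩

variable [CompleteSpace F]

/-- The modulus `|x + iy| = sup_θ (cos θ • x + sin θ • y)`, an element of `F`. -/
def modulus (z : LatticeCplx F) : F := (exists_isLUB_rot z.re z.im).choose

theorem isLUB_modulus (z : LatticeCplx F) : IsLUB (range (rot z.re z.im)) z.modulus :=
  (exists_isLUB_rot z.re z.im).choose_spec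

theorem rot_le_modulus (z : LatticeCplx F) (θ : ℝ) : rot z.re z.im θ ≤ z.modulus :=
  (isLUB_modulus z).1 ⟨θ, rfl⟩

theorem modulus_le {z : LatticeCplx F} {b : F} (h : ∀ θ, rot z.re z.im θ ≤ b) : z.modulus ≤ b :=
  (isLUB_modulus z).2 (by rintro _ ⟨θ, rfl⟩; exact h θ)

theorem abs_re_le (z : LatticeCplx F) : |z.re| ≤ z.modulus :=
  abs_le'.2 ⟨by simpa [rot] using rot_le_modulus z 0,
    by simpa [rot] using rot_le_modulus z Real.pi⟩

theorem abs_im_le (z : LatticeCplx F) : |z.im| ≤ z.modulus :=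
  abs_le'.2 ⟨by simpa [rot] using rot_le_modulus z (Real.pi / 2),
    by simpa [rot] using rot_le_modulus z (-(Real.pi / 2))⟩

theorem modulus_nonneg (z : LatticeCplx F) : 0 ≤ z.modulus := (abs_nonneg _).trans (abs_re_le z)

theorem modulus_le_add (z : LatticeCplx F) : z.modulus ≤ |z.re| + |z.im| := by
  refine modulus_le fun θ => add_le_add ?_ ?_
  · refine (smul_le_smul_abs _ _).trans ?_
    simpa using smul_le_smul_of_nonneg_right (Real.abs_cos_le_one θ) (abs_nonneg z.re)
  · refine (smul_le_smul_abs _ _).trans ?_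
    simpa using smul_le_smul_of_nonneg_right (Real.abs_sin_le_one θ) (abs_nonneg z.im)

theorem modulus_add_le (z w : LatticeCplx F) : (z + w).modulus ≤ z.modulus + w.modulus := by
  refine modulus_le fun θ => ?_
  have : rot (z + w).re (z + w).im θ = rot z.re z.im θ + rot w.re w.im θ := by
    simp only [rot, add_re, add_im]; module
  rw [this]
  exact add_le_add (rot_le_modulus z θ) (rot_le_modulus w θ)

theorem modulus_smul_le (a : ℂ) (z : LatticeCplx F) : (a • z).modulus ≤ ‖a‖ • z.modulus := by
  refine modulus_le fun θ => ?_
  have h : rot (a • z).re (a • z).im θ = ‖a‖ • rot z.re z.im (θ - a.arg) := by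
    have hr := Complex.norm_mul_cos_arg a
    have hi := Complex.norm_mul_sin_arg a
    simp only [rot, smul_re, smul_im, Real.cos_sub, Real.sin_sub]
    rw [← hr, ← hi]
    module
  rw [h]
  exact smul_le_smul_of_nonneg_left (rot_le_modulus z _) (norm_nonneg a)

theorem norm_le_of_le {x y : F} (hx : 0 ≤ x) (h : x ≤ y) : ‖x‖ ≤ ‖y‖ :=
  norm_le_norm_of_abs_le_abs (by rwa [abs_of_nonneg hx, abs_of_nonneg (hx.trans h)])

theorem norm_re_le_modulus (z : LatticeCplx F) : ‖z.re‖ ≤ ‖z.modulus‖ := by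
  rw [← norm_abs_eq_norm z.re]
  exact norm_le_of_le (abs_nonneg _) (abs_re_le z)

theorem norm_im_le_modulus (z : LatticeCplx F) : ‖z.im‖ ≤ ‖z.modulus‖ := by
  rw [← norm_abs_eq_norm z.im]
  exact norm_le_of_le (abs_nonneg _) (abs_im_le z)

theorem norm_modulus_le_add (z : LatticeCplx F) : ‖z.modulus‖ ≤ ‖z.re‖ + ‖z.im‖ := by
  rw [← norm_abs_eq_norm z.re, ← norm_abs_eq_norm z.im]
  exact (norm_le_of_le (modulus_nonneg z) (modulus_le_add z)).trans (norm_add_le _ _)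

theorem norm_modulus_smul_le (a : ℂ) (z : LatticeCplx F) :
    ‖(a • z).modulus‖ ≤ ‖a‖ * ‖z.modulus‖ := by
  have := norm_le_of_le (modulus_nonneg _) (modulus_smul_le a z)
  rwa [norm_smul, norm_norm] at this

instance : Norm (LatticeCplx F) := ⟨fun z => ‖z.modulus‖⟩

theorem normedSpaceCore : NormedSpace.Core ℂ (LatticeCplx F) where
  norm_nonneg z := norm_nonneg z.modulus
  norm_smul a z := by
    refine le_antisymm (norm_modulus_smul_le a z) ?_
    rcases eq_or_ne a 0 with rfl | ha
    · rw [norm_zero, zero_mul]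
      exact norm_nonneg ((0 : ℂ) • z).modulus
    · have h := norm_modulus_smul_le a⁻¹ (a • z)
      rw [smul_smul, inv_mul_cancel₀ ha, one_smul, norm_inv] at h
      have ha' : 0 < ‖a‖ := norm_pos_iff.2 ha
      rwa [inv_mul_eq_div, le_div_iff₀ ha', mul_comm] at h
  norm_triangle z w :=
    (norm_le_of_le (modulus_nonneg _) (modulus_add_le z w)).trans (norm_add_le _ _)
  norm_eq_zero_iff z := by
    change ‖z.modulus‖ = 0 ↔ z = 0
    constructor
    · intro h
      have h1 := norm_re_le_modulus z
      have h2 := norm_im_le_modulus z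
      rw [h] at h1 h2
      ext
      · exact norm_le_zero_iff.1 h1
      · exact norm_le_zero_iff.1 h2
    · rintro rfl
      exact le_antisymm (by simpa using norm_modulus_le_add (0 : LatticeCplx F)) (norm_nonneg _)

instance : NormedAddCommGroup (LatticeCplx F) := NormedAddCommGroup.ofCore normedSpaceCore

instance : NormedSpace ℂ (LatticeCplx F) where
  norm_smul_le a z := norm_modulus_smul_le a z

theorem norm_eq (z : LatticeCplx F) : ‖z‖ = ‖z.modulus‖ := rfl

theorem dist_eq (z w : LatticeCplx F) : dist z w = ‖(z - w).modulus‖ := by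
  rw [dist_eq_norm, norm_eq]

theorem dist_le_add (z w : LatticeCplx F) : dist z w ≤ ‖z.re - w.re‖ + ‖z.im - w.im‖ := by
  rw [dist_eq]
  exact norm_modulus_le_add (z - w)

instance : CompleteSpace (LatticeCplx F) := by
  refine Metric.complete_of_cauchySeq_tendsto fun s hs => ?_
  rw [Metric.cauchySeq_iff] at hs
  have hre : CauchySeq fun n => (s n).re := by
    rw [Metric.cauchySeq_iff]
    intro ε hε
    obtain ⟨N, hN⟩ := hs ε hε
    refine ⟨N, fun m hm n hn => lt_of_le_of_lt ?_ (hN m hm n hn)⟩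
    rw [dist_eq_norm, dist_eq]
    exact norm_re_le_modulus (s m - s n)
  have him : CauchySeq fun n => (s n).im := by
    rw [Metric.cauchySeq_iff]
    intro ε hε
    obtain ⟨N, hN⟩ := hs ε hε
    refine ⟨N, fun m hm n hn => lt_of_le_of_lt ?_ (hN m hm n hn)⟩
    rw [dist_eq_norm, dist_eq]
    exact norm_im_le_modulus (s m - s n)
  obtain ⟨x, hx⟩ := cauchySeq_tendsto_of_complete hre
  obtain ⟨y, hy⟩ := cauchySeq_tendsto_of_complete him
  refine ⟨⟨x, y⟩, ?_⟩
  rw [tendsto_iff_norm_sub_tendsto_zero] at hx hy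
  rw [tendsto_iff_dist_tendsto_zero]
  have h0 : Tendsto (fun n => ‖(s n).re - x‖ + ‖(s n).im - y‖) atTop (𝓝 0) := by
    simpa using hx.add hy
  exact squeeze_zero (fun n => dist_nonneg) (fun n => dist_le_add (s n) ⟨x, y⟩) h0

/-- The principal ideal `E_u = {z | |z| ≤ c u for some c > 0}`. -/
def principalIdeal (u : F) : Set (LatticeCplx F) := {z | ∃ c : ℝ, 0 < c ∧ z.modulus ≤ c • u}

/-- The gauge norm `inf {c > 0 | |z| ≤ c u}` of `E_u` (used for elements of `E_u` only). -/
def gaugeNorm (u : F) (z : LatticeCplx F) : ℝ := sInf {c : ℝ | 0 < c ∧ z.modulus ≤ c • u}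

end Modulus

/-- A partially defined operator on the complexification is real if its domain is the
complexification of the set of its real elements and it maps real elements to real elements. -/
def IsRealOp {F : Type*} [AddCommGroup F] [Module ℝ F]
    (A : LatticeCplx F →ₗ.[ℂ] LatticeCplx F) : Prop :=
  (∀ z ∈ A.domain, ofReal z.re ∈ A.domain ∧ ofReal z.im ∈ A.domain) ∧
    ∀ (x : F) (hx : ofReal x ∈ A.domain), (A ⟨ofReal x, hx⟩).im = 0

end LatticeCplx

/-! ## Unbounded operators: resolvent, poles, eigenvalues -/

namespace UnboundedOp

variable {E : Type*} [NormedAddCommGroup E] [NormedSpace ℂ E]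

/-- `R` is a bounded two-sided inverse of `μ - A : dom A → E`. -/
def IsResolventAt (A : E →ₗ.[ℂ] E) (μ : ℂ) (R : E →L[ℂ] E) : Prop :=
  (∀ y : E, ∃ h : R y ∈ A.domain, μ • R y - A ⟨R y, h⟩ = y) ∧
    ∀ x : A.domain, R (μ • (x : E) - A x) = x

/-- The resolvent set `ρ(A)`. -/
def resolventSet (A : E →ₗ.[ℂ] E) : Set ℂ := {μ | ∃ R : E →L[ℂ] E, IsResolventAt A μ R}

/-- The spectrum `σ(A)`. -/
def spectrum (A : E →ₗ.[ℂ] E) : Set ℂ := (resolventSet A)ᶜ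

open Classical in
/-- The resolvent `R(μ, A) = (μ - A)⁻¹` for `μ ∈ ρ(A)` (and `0` elsewhere). -/
def resolvent (A : E →ₗ.[ℂ] E) (μ : ℂ) : E →L[ℂ] E :=
  if h : μ ∈ resolventSet A then h.choose else 0

/-- `μ₀` is an isolated point of the spectrum at which the resolvent has a pole. -/
def IsPoleOfResolvent (A : E →ₗ.[ℂ] E) (μ₀ : ℂ) : Prop :=
  μ₀ ∈ spectrum A ∧ (∀ᶠ μ in 𝓝[≠] μ₀, μ ∈ resolventSet A) ∧
    MeromorphicAt (resolvent A) μ₀ ∧ meromorphicOrderAt (resolvent A) μ₀ < 0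

/-- `v` is an eigenvector of `A` for the eigenvalue `μ`. -/
def IsEigenvector (A : E →ₗ.[ℂ] E) (μ : ℂ) (v : E) : Prop :=
  v ≠ 0 ∧ ∃ h : v ∈ A.domain, A ⟨v, h⟩ = μ • v

/-- `μ` is an eigenvalue of `A`. -/
def IsEigenvalue (A : E →ₗ.[ℂ] E) (μ : ℂ) : Prop := ∃ v, IsEigenvector A μ v

/-- `ker ((μ - A)^m)`: the kernel of the `(m+1)`-st power consists of those `x ∈ dom A` for which
`(μ - A) x` lies in the kernel of the `m`-th power. -/
def kerPow (A : E →ₗ.[ℂ] E) (μ : ℂ) : ℕ → Submodule ℂ E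
  | 0 => ⊥
  | m + 1 => ((kerPow A μ m).comap (μ • A.domain.subtype - A.toFun)).map A.domain.subtype

/-- The generalised eigenspace: the union of the increasing sequence `ker ((μ - A)^m)`. -/
def genEigenspace (A : E →ₗ.[ℂ] E) (μ : ℂ) : Submodule ℂ E := ⨆ m, kerPow A μ m

/-- `μ` is an algebraically simple eigenvalue: its generalised eigenspace is one-dimensional. -/
def IsAlgSimple (A : E →ₗ.[ℂ] E) (μ : ℂ) : Prop :=
  IsEigenvalue A μ ∧ Module.finrank ℂ (genEigenspace A μ) = 1

/-- An operator given on the domain of `A`, as a partially defined operator. -/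
def onDomain (A : E →ₗ.[ℂ] E) (B : A.domain →ₗ[ℂ] E) : E →ₗ.[ℂ] E := ⟨A.domain, B⟩

/-- The operator `A + B` with domain `dom A`. -/
def perturb (A : E →ₗ.[ℂ] E) (B : A.domain →ₗ[ℂ] E) : E →ₗ.[ℂ] E := ⟨A.domain, A.toFun + B⟩

open Classical in
/-- The value `B y` for `y ∈ dom A` (and `0` elsewhere). -/
def evalAt {A : E →ₗ.[ℂ] E} (B : A.domain →ₗ[ℂ] E) (y : E) : E :=
  if h : y ∈ A.domain then B ⟨y, h⟩ else 0

/-- The supremum of the operator norms `‖B R(μ, A)‖` over the real `μ` with `|μ - μ₀| = r`. -/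
def betaSup {A : E →ₗ.[ℂ] E} (B : A.domain →ₗ[ℂ] E) (μ₀ r : ℝ) : ENNReal :=
  ⨆ (μ : ℝ) (_ : |μ - μ₀| = r) (x : E) (_ : ‖x‖ ≤ 1), ‖evalAt B (resolvent A μ x)‖ₑ

end UnboundedOp

/-! ## Strongly continuous semigroups -/

/-- A `C₀`-semigroup of bounded operators on `E`; only the values at `t ≥ 0` matter. -/
structure C0Semigroup (E : Type*) [NormedAddCommGroup E] [NormedSpace ℂ E] where
  /-- the operators `T(t)` -/
  T : ℝ → E →L[ℂ] E
  map_zero : T 0 = ContinuousLinearMap.id ℂ E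
  map_add : ∀ s t : ℝ, 0 ≤ s → 0 ≤ t → T (s + t) = (T s).comp (T t)
  tendsto_zero : ∀ x : E, Tendsto (fun t => T t x) (𝓝[>] 0) (𝓝 x)

namespace C0Semigroup

variable {E : Type*} [NormedAddCommGroup E] [NormedSpace ℂ E]

/-- `y` is the limit of the difference quotients `(T(t) x - x) / t` as `t ↓ 0`. -/
def HasGen (S : C0Semigroup E) (x y : E) : Prop :=
  Tendsto (fun t : ℝ => ((t⁻¹ : ℝ) : ℂ) • (S.T t x - x)) (𝓝[>] 0) (𝓝 y)

theorem HasGen.add {S : C0Semigroup E} {x y x' y' : E} (h : S.HasGen x y) (h' : S.HasGen x' y') :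
    S.HasGen (x + x') (y + y') := by
  refine (Tendsto.add h h').congr fun t => ?_
  rw [_root_.map_add (S.T t)]
  module

theorem HasGen.smul {S : C0Semigroup E} {x y : E} (a : ℂ) (h : S.HasGen x y) :
    S.HasGen (a • x) (a • y) := by
  refine (Tendsto.const_smul h a).congr fun t => ?_
  rw [_root_.map_smul (S.T t)]
  module

/-- The generator: its domain consists of the `x` for which the difference quotients converge,
and its value at `x` is the limit. -/
def generator (S : C0Semigroup E) : E →ₗ.[ℂ] E where
  domain :=
    { carrier := {x | ∃ y, S.HasGen x y}
      add_mem' := fun ⟨_, h⟩ ⟨_, h'⟩ => ⟨_, h.add h'⟩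
      zero_mem' := ⟨0, by simp [HasGen]⟩
      smul_mem' := fun a _ ⟨_, h⟩ => ⟨_, h.smul a⟩ }
  toFun :=
    { toFun := fun x => x.2.choose
      map_add' := fun x x' => tendsto_nhds_unique (x + x').2.choose_spec
        (x.2.choose_spec.add x'.2.choose_spec)
      map_smul' := fun a x => tendsto_nhds_unique (a • x).2.choose_spec
        (x.2.choose_spec.smul a) }

theorem hasGen_generator (S : C0Semigroup E) (x : S.generator.domain) :
    S.HasGen x (S.generator x) := x.2.choose_spec

/-- All orbits `t ↦ T(t) x` are differentiable on `(0, ∞)`. -/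
def ImmediatelyDifferentiable (S : C0Semigroup E) : Prop :=
  ∀ (x : E) (t : ℝ), 0 < t → DifferentiableAt ℝ (fun s => S.T s x) t

/-- `B` is bounded from `dom A`, with the graph norm of the generator `A`, to `E`. -/
def GraphBounded (S : C0Semigroup E) (B : S.generator.domain →ₗ[ℂ] E) : Prop :=
  ∃ M : ℝ, ∀ x : S.generator.domain, ‖B x‖ ≤ M * (‖(x : E)‖ + ‖S.generator x‖)

/-- `∫₀^{t₀} ‖B T(s) x‖ ds ≤ q ‖x‖` on `dom A`, for some `q ∈ (0, 1)` and `t₀ > 0`. -/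
def Admissible (S : C0Semigroup E) (B : S.generator.domain →ₗ[ℂ] E) : Prop :=
  ∃ q t₀ : ℝ, 0 < q ∧ q < 1 ∧ 0 < t₀ ∧ ∀ x ∈ S.generator.domain,
    ∫ s in (0 : ℝ)..t₀, ‖UnboundedOp.evalAt B (S.T s x)‖ ≤ q * ‖x‖

end C0Semigroup

namespace LatticeCplx

variable {F : Type*} [NormedAddCommGroup F] [Lattice F] [HasSolidNorm F] [IsOrderedAddMonoid F]
  [NormedSpace ℝ F] [IsOrderedModule ℝ F] [CompleteSpace F]

/-- Ultracontractivity with respect to `E_u`: `T(t) E ⊆ E_u` with `‖T(t)‖_{E → E_u} ≤ C t^{-α}`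
for `t ∈ (0, 1]`. -/
def Ultracontractive (S : C0Semigroup (LatticeCplx F)) (u : F) : Prop :=
  ∃ C α : ℝ, 1 ≤ C ∧ 0 < α ∧ ∀ t ∈ Ioc (0 : ℝ) 1, ∀ x : LatticeCplx F,
    S.T t x ∈ principalIdeal u ∧ gaugeNorm u (S.T t x) ≤ C * t ^ (-α) * ‖x‖

/-- The estimates on `E_u`: `‖T(t)‖_{E_u → E_u} ≤ C` and `‖B T(t) x‖_{E_u} ≤ C t^{-β} ‖x‖_{E_u}`
for `t ∈ (0, 1]` and `x ∈ E_u` with `T(t) x` in the domain of `B`. -/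
def IdealBounds (S : C0Semigroup (LatticeCplx F))
    (B : S.generator.domain →ₗ[ℂ] LatticeCplx F) (u : F) : Prop :=
  ∃ C β : ℝ, 1 ≤ C ∧ 0 ≤ β ∧ β < 1 ∧ ∀ t ∈ Ioc (0 : ℝ) 1, ∀ x ∈ principalIdeal u,
    (S.T t x ∈ principalIdeal u ∧ gaugeNorm u (S.T t x) ≤ C * gaugeNorm u x) ∧
    ∀ h : S.T t x ∈ S.generator.domain,
      B ⟨S.T t x, h⟩ ∈ principalIdeal u ∧
        gaugeNorm u (B ⟨S.T t x, h⟩) ≤ C * t ^ (-β) * gaugeNorm u x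

end LatticeCplx

end

/-! Fix μ₀ = l₀ + r in the resolvent set and write B(κ) = b(κ)(μ₀ - A) with b(κ) bounded on E.
Strong holomorphy, the uniform boundedness principle and the Schwarz lemma give ‖b(κ)‖ = O(|κ|). The
Laurent expansion of the resolvent at l₀ provides a functional φ with φ(v₀) = 1 and a reduced
resolvent H (`exists_isReducedResolvent`). An eigenvector normalised by φ(v) = 1 has the form v = v₀
+ Hz with z = (l₀ - A)v. Applying φ to the eigenvalue equation identifies the eigenvalue as l₀ +
φ(B(κ)v), so only a fixed point equation for z remains. It is a contraction for small κ, its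
solution is holomorphic in κ, and the same estimates exclude Jordan chains and further eigenvalues
near l₀. The remaining part of the real interval is a compact subset of the resolvent set, where
openness of the invertible operators suffices. For real κ, conjugation and uniqueness make the
eigenpair real.

The lower bound requires v(κ) → v₀ in the gauge norm of E_u, whereas the contraction argument gives
convergence in E only. With w(κ) = B(κ)v(κ), variation of constants reads v(κ) = e^{-λt} T(t)v(κ) +
∫₀ᵗ e^{-λs} T(s)w(κ) ds, where λ = λ(κ). For fixed t the first term converges in E_u, because T(t)
maps E boundedly into E_u. The integral must be small as t → 0, uniformly in κ. The a priori bound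
s^{-α} need not be integrable, and the constants of the estimates for B(κ) on E_u are not controlled
in κ.

The way out is a Hartogs-type argument (`exists_norm_le_rpow_of_pointwise_bounded`). A Volterra
equation shows w(κ) ∈ E_u for each κ (`perturbation_eigenvector_mem_principalIdeal`), so s ↦
‖T(s)w(κ)‖ in E_u is bounded on (0, 1], with a bound depending on κ. Its log⁺ has the sub-mean value
property in κ. The set where a large bound m fails has small measure, and averaging over a disc
therefore lowers the exponent α to 1/2, locally uniformly in κ. Since s^{-1/2} is integrable, the
convergence in E_u follows. -/

/-! ### Sub-mean value property of log⁺ and a Hartogs-type lemma -/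

open MeasureTheory Real in
-- Jensen's formula: for holomorphic g the zeros in the disc contribute nonnegative terms. Points
-- with ‖g c‖ ≤ 1 are trivial, which also disposes of the case g c = 0.
theorem posLog_norm_le_circleAverage {g : ℂ → ℂ} {c : ℂ} {r R : ℝ} (hr : 0 < r) (hrR : r < R)
    (hg : DifferentiableOn ℂ g (Metric.ball c R)) :
    log⁺ ‖g c‖ ≤ circleAverage (fun z => log⁺ ‖g z‖) c r := by
  have hnn : 0 ≤ circleAverage (fun z => log⁺ ‖g z‖) c r :=
    circleAverage_nonneg_of_nonneg fun _ _ => posLog_nonneg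
  rcases le_or_gt ‖g c‖ 1 with h1 | h1
  · rwa [(posLog_eq_zero_iff _).2 (by simpa using h1)]
  have hne : g c ≠ 0 := by
    intro h; rw [h, norm_zero] at h1; linarith
  have hsub : Metric.closedBall c |r| ⊆ Metric.ball c R := by
    rw [abs_of_pos hr]; exact Metric.closedBall_subset_ball hrR
  have han : AnalyticOnNhd ℂ g (Metric.closedBall c |r|) :=
    (hg.analyticOnNhd Metric.isOpen_ball).mono hsub
  have hj := han.circleAverage_log_norm hr.ne' hne
  have hsum : 0 ≤ ∑ᶠ w, (MeromorphicOn.divisor g (Metric.closedBall c |r|) w : ℝ) *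
      Real.log (r * ‖c - w‖⁻¹) := by
    refine finsum_nonneg fun w => ?_
    by_cases hw : w ∈ Metric.closedBall c |r|
    · refine mul_nonneg ?_ ?_
      · exact_mod_cast MeromorphicOn.AnalyticOnNhd.divisor_nonneg han w
      -- At w = c the conventions 0⁻¹ = 0 and log 0 = 0 make the term vanish.
      · rcases eq_or_ne c w with rfl | hcw
        · simp
        · apply Real.log_nonneg
          have : 0 < ‖c - w‖ := norm_pos_iff.2 (sub_ne_zero.2 hcw)
          rw [← div_eq_mul_inv, one_le_div this]
          rw [abs_of_pos hr] at hw
          rwa [Metric.mem_closedBall, dist_comm, dist_eq_norm] at hw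
    · rw [Function.locallyFinsuppWithin.apply_eq_zero_of_notMem _ hw]; simp
  have hle : circleAverage (fun z => Real.log ‖g z‖) c r ≤
      circleAverage (fun z => log⁺ ‖g z‖) c r := by
    refine circleAverage_mono ?_ ?_ fun z _ => ?_
    · apply MeromorphicOn.circleIntegrable_log_norm
      exact fun z hz => (han z (Metric.sphere_subset_closedBall hz)).meromorphicAt
    · refine ContinuousOn.circleIntegrable' ?_
      exact continuous_posLog.comp_continuousOn ((hg.continuousOn.mono
        (Metric.sphere_subset_closedBall.trans hsub)).norm)
    · rw [posLog_apply]; exact le_max_right _ _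
  rw [posLog_eq_log (by simpa using h1.le)]
  linarith

open MeasureTheory in
theorem setLIntegral_ball_eq_polar {f : ℂ → ENNReal} {c : ℂ} {R : ℝ}
    (hf : Measurable ((Metric.ball c R).indicator f)) :
    ∫⁻ z in Metric.ball c R, f z =
      ∫⁻ r in Ioo 0 R, ENNReal.ofReal r * ∫⁻ θ in Ioo (-Real.pi) Real.pi, f (circleMap c r θ) := by
  set F := (Metric.ball c R).indicator f with hF
  have hcm : ∀ p : ℝ × ℝ, c + Complex.polarCoord.symm p = circleMap c p.1 p.2 := fun p => by
    rw [Complex.polarCoord_symm_apply, circleMap, Complex.exp_mul_I]; push_cast; ring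
  have hmeas : Measurable fun p : ℝ × ℝ => F (circleMap c p.1 p.2) := by
    refine hf.comp (Continuous.measurable ?_)
    simp only [circleMap]; fun_prop
  rw [← lintegral_indicator measurableSet_ball, ← hF, ← lintegral_add_left_eq_self F c,
    ← Complex.lintegral_comp_polarCoord_symm]
  simp only [hcm, smul_eq_mul]
  have hmeas' : Measurable fun p : ℝ × ℝ => ENNReal.ofReal p.1 * F (circleMap c p.1 p.2) :=
    measurable_fst.ennreal_ofReal.mul hmeas
  rw [polarCoord_target, Measure.volume_eq_prod, ← Measure.prod_restrict,
    lintegral_prod _ hmeas'.aemeasurable]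
  rw [← lintegral_indicator measurableSet_Ioi, ← lintegral_indicator measurableSet_Ioo]
  refine lintegral_congr fun r => ?_
  have hin : ∀ θ, 0 < r → (circleMap c r θ ∈ Metric.ball c R ↔ r < R) := fun θ hr => by
    simp [circleMap, abs_of_pos hr]
  by_cases hr : 0 < r
  · rw [indicator_of_mem (mem_Ioi.2 hr)]
    rw [lintegral_const_mul' _ _ ENNReal.ofReal_ne_top]
    by_cases hrR : r < R
    · rw [indicator_of_mem (show r ∈ Ioo 0 R from ⟨hr, hrR⟩)]
      congr 1
      refine lintegral_congr fun θ => ?_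
      rw [hF, indicator_of_mem ((hin θ hr).2 hrR)]
    · rw [indicator_of_notMem (show r ∉ Ioo 0 R from fun h => hrR h.2)]
      have : ∀ θ, F (circleMap c r θ) = 0 := fun θ => by
        rw [hF, indicator_of_notMem (fun h => hrR ((hin θ hr).1 h))]
      simp [this]
  · rw [indicator_of_notMem (by simpa using hr),
      indicator_of_notMem (show r ∉ Ioo 0 R from fun h => hr h.1)]

open MeasureTheory in
/-- A circular sub-mean value property implies the one over discs. -/
theorem ofReal_mul_volume_ball_le_lintegral {h : ℂ → ℝ} {c : ℂ} {R a : ℝ}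
    (hcont : ContinuousOn h (Metric.ball c R)) (hnn : ∀ z, 0 ≤ h z)
    (hmean : ∀ r, 0 < r → r < R → a ≤ Real.circleAverage h c r) :
    ENNReal.ofReal a * volume (Metric.ball c R) ≤
      ∫⁻ z in Metric.ball c R, ENNReal.ofReal (h z) := by
  have hm1 : Measurable ((Metric.ball c R).indicator fun z => ENNReal.ofReal (h z)) := by
    classical
    rw [← piecewise_eq_indicator]
    exact (ENNReal.continuous_ofReal.comp_continuousOn hcont).measurable_piecewise
      continuousOn_const measurableSet_ball
  -- The constant is integrated in polar coordinates as well, so that the two sides can be compared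
  -- circle by circle.
  rw [setLIntegral_ball_eq_polar hm1, ← setLIntegral_const, setLIntegral_ball_eq_polar
    (measurable_const.indicator measurableSet_ball)]
  refine setLIntegral_mono' measurableSet_Ioo fun r hr => ?_
  gcongr 1
  have hcirc : Continuous fun θ => h (circleMap c r θ) := by
    refine hcont.comp_continuous (continuous_circleMap c r) fun θ => ?_
    simp [circleMap, abs_of_pos hr.1, hr.2]
  have hint : IntegrableOn (fun θ => h (circleMap c r θ)) (Ioo (-Real.pi) Real.pi) :=
    (hcirc.integrableOn_Icc).mono_set Ioo_subset_Icc_self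
  rw [← ofReal_integral_eq_lintegral_ofReal hint (ae_of_all _ fun θ => hnn _), setLIntegral_const,
    Real.volume_Ioo, mul_comm, ← ENNReal.ofReal_mul (by linarith [Real.pi_pos])]
  apply ENNReal.ofReal_le_ofReal
  -- Polar coordinates use the angles (-π, π), circle averages use (0, 2π); periodicity identifies
  -- the two integrals.
  have hper : Function.Periodic (fun θ => h (circleMap c r θ)) (2 * Real.pi) :=
    fun θ => by simp only [periodic_circleMap c r θ]
  have h1 := hmean r hr.1 hr.2
  rw [Real.circleAverage_def, ← integral_Ioc_eq_integral_Ioo, ← intervalIntegral.integral_of_le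
    (by linarith [Real.pi_pos])] at *
  have h2 := hper.intervalIntegral_add_eq 0 (-Real.pi)
  rw [zero_add, show -Real.pi + 2 * Real.pi = Real.pi by ring] at h2
  rw [h2, smul_eq_mul, ← div_eq_inv_mul, le_div_iff₀ (by positivity)] at h1
  linarith

open MeasureTheory Real in
/-- `log⁺ ‖f‖` has the sub-mean value property over discs for holomorphic vector-valued `f`. -/
theorem posLog_norm_mul_volume_ball_le_lintegral {U : Type*} [NormedAddCommGroup U]
    [NormedSpace ℂ U] {f : ℂ → U} {c : ℂ} {R : ℝ}
    (hf : DifferentiableOn ℂ f (Metric.ball c R)) :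
    ENNReal.ofReal (log⁺ ‖f c‖) * volume (Metric.ball c R) ≤
      ∫⁻ z in Metric.ball c R, ENNReal.ofReal (log⁺ ‖f z‖) := by
  -- A norming functional at the centre reduces the claim to scalar functions: equality at c, and ‖ψ
  -- (f z)‖ ≤ ‖f z‖ elsewhere.
  obtain ⟨ψ, hψ, hψc⟩ := exists_dual_vector'' ℂ (f c)
  have hd : DifferentiableOn ℂ (fun z => ψ (f z)) (Metric.ball c R) :=
    ψ.differentiable.comp_differentiableOn hf
  have h1 := ofReal_mul_volume_ball_le_lintegral (h := fun z => log⁺ ‖ψ (f z)‖)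
    (a := log⁺ ‖ψ (f c)‖) (continuous_posLog.comp_continuousOn hd.continuousOn.norm)
    (fun _ => posLog_nonneg) (fun r hr hrR => posLog_norm_le_circleAverage hr hrR hd)
  have h2 : ‖ψ (f c)‖ = ‖f c‖ := by rw [hψc]; simp
  rw [h2] at h1
  refine h1.trans (lintegral_mono fun z => ENNReal.ofReal_le_ofReal ?_)
  refine posLog_le_posLog (norm_nonneg _) ?_
  simpa using ψ.le_of_opNorm_le hψ (f z)

open MeasureTheory Real in
/-- A Hartogs-type lemma: polynomial growth of `L t ∘ f` as `t → 0`, uniform in the parameter,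
together with pointwise boundedness, implies an arbitrarily slow growth, locally uniformly. -/
theorem exists_norm_le_rpow_of_pointwise_bounded {E U : Type*} [NormedAddCommGroup E]
    [NormedSpace ℂ E] [NormedAddCommGroup U] [NormedSpace ℂ U] (L : ℝ → E →L[ℂ] U)
    {C α : ℝ} (hα : 0 < α) (hL : ∀ t ∈ Ioc (0 : ℝ) 1, ∀ x, ‖L t x‖ ≤ C * t ^ (-α) * ‖x‖)
    {f : ℂ → E} {ρ : ℝ} (hρ : 0 < ρ) (hf : DifferentiableOn ℂ f (Metric.ball 0 ρ))
    (hpt : ∀ κ ∈ Metric.ball (0 : ℂ) ρ, ∃ m : ℝ, ∀ t ∈ Ioc (0 : ℝ) 1, ‖L t (f κ)‖ ≤ m) :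
    ∃ ρ' > 0, ∃ K : ℝ, ∀ κ ∈ Metric.ball (0 : ℂ) ρ', ∀ t ∈ Ioc (0 : ℝ) 1,
      ‖L t (f κ)‖ ≤ K * t ^ (-(1 / 2) : ℝ) := by
  -- Discs of radius R about points of the R-ball stay in a compact disc of radius 2R, on which f is
  -- bounded.
  obtain ⟨R, hR, hRρ⟩ : ∃ R > 0, 2 * R < ρ := ⟨ρ / 4, by positivity, by linarith⟩
  have hsub : Metric.closedBall (0 : ℂ) (2 * R) ⊆ Metric.ball 0 ρ :=
    Metric.closedBall_subset_ball hRρ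
  obtain ⟨M, hM⟩ := (isCompact_closedBall (0 : ℂ) (2 * R)).exists_bound_of_continuousOn
    (hf.continuousOn.mono hsub)
  -- D ≥ 1 ensures D t^{-α} ≥ 1, so that log and log⁺ agree there.
  set D : ℝ := max 1 (|C| * |M|) with hD
  have hD1 : 1 ≤ D := le_max_left _ _
  have hLD : ∀ κ ∈ Metric.closedBall (0 : ℂ) (2 * R), ∀ t ∈ Ioc (0 : ℝ) 1,
      ‖L t (f κ)‖ ≤ D * t ^ (-α) := by
    intro κ hκ t ht
    have h0 : 0 ≤ t ^ (-α) := (Real.rpow_pos_of_pos ht.1 _).le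
    calc ‖L t (f κ)‖ ≤ C * t ^ (-α) * ‖f κ‖ := hL t ht _
      _ ≤ |C| * t ^ (-α) * |M| := by
        gcongr
        · exact le_abs_self C
        · exact (hM κ hκ).trans (le_abs_self M)
      _ = (|C| * |M|) * t ^ (-α) := by ring
      _ ≤ D * t ^ (-α) := by gcongr; exact le_max_right _ _
  -- the exceptional sets
  let Ω : ℕ → Set ℂ := fun m => {κ ∈ Metric.closedBall (0 : ℂ) (2 * R) |
    ∀ t ∈ Ioc (0 : ℝ) 1, ‖L t (f κ)‖ ≤ (m + 1 : ℕ)}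
  have hΩc : ∀ m, IsClosed (Ω m) := by
    intro m
    have : Ω m = Metric.closedBall (0 : ℂ) (2 * R) ∩ ⋂ t ∈ Ioc (0 : ℝ) 1,
        (Metric.closedBall (0 : ℂ) (2 * R) ∩
          (fun κ => ‖L t (f κ)‖) ⁻¹' Iic ((m + 1 : ℕ) : ℝ)) := by
      ext κ
      simp only [Ω, mem_ofPred_eq, mem_inter_iff, mem_iInter, mem_preimage, mem_Iic]
      grind
    rw [this]
    refine Metric.isClosed_closedBall.inter (isClosed_biInter fun t _ => ?_)
    exact ((L t).continuous.comp_continuousOn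
      (hf.continuousOn.mono hsub)).norm.preimage_isClosed_of_isClosed Metric.isClosed_closedBall isClosed_Iic
  let X : ℕ → Set ℂ := fun m => Metric.closedBall (0 : ℂ) (2 * R) \ Ω m
  have hXanti : Antitone X := by
    intro m n hmn κ hκ
    refine ⟨hκ.1, fun h => hκ.2 ⟨h.1, fun t ht => (h.2 t ht).trans ?_⟩⟩
    exact_mod_cast Nat.succ_le_succ hmn
  have hXmeas : ∀ m, MeasurableSet (X m) := fun m =>
    measurableSet_closedBall.diff (hΩc m).measurableSet
  -- Pointwise boundedness says that the decreasing sets X m have empty intersection; they have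
  -- finite measure, so continuity from above applies.
  have hXlim : Tendsto (fun m => volume (X m)) atTop (𝓝 0) := by
    have h1 := tendsto_measure_iInter_atTop (μ := (volume : Measure ℂ))
      (fun m => (hXmeas m).nullMeasurableSet) hXanti
      ⟨0, ((measure_mono sdiff_subset).trans_lt measure_closedBall_lt_top).ne⟩
    have h2 : ⋂ m, X m = ∅ := by
      rw [eq_empty_iff_forall_notMem]
      intro κ hκ
      rw [mem_iInter] at hκ
      obtain ⟨m, hm⟩ := hpt κ (hsub (hκ 0).1)
      obtain ⟨n, hn⟩ := exists_nat_ge m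
      refine (hκ n).2 ⟨(hκ 0).1, fun t ht => (hm t ht).trans (hn.trans ?_)⟩
      exact_mod_cast Nat.le_succ n
    rwa [h2, measure_empty] at h1
  set V : ENNReal := volume (Metric.ball (0 : ℂ) R) with hV
  have hV0 : V ≠ 0 := (Metric.measure_ball_pos _ _ hR).ne'
  have hVt : V ≠ ⊤ := measure_ball_lt_top.ne
  -- If the exceptional set fills at most the fraction η of a disc of radius R, the bound D t^{-α}
  -- enters the mean only with the exponent η, and αη = 1/2.
  set η : ℝ := 1 / (2 * α) with hη
  have hη0 : 0 < η := by positivity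
  obtain ⟨m, hm⟩ : ∃ m, volume (X m) < ENNReal.ofReal η * V :=
    (hXlim.eventually_lt_const (ENNReal.mul_pos (by simpa using hη0) hV0)).exists
  refine ⟨R, hR, (m + 1 : ℕ) * D ^ η, fun κ hκ t ht => ?_⟩
  have hball : Metric.ball κ R ⊆ Metric.closedBall (0 : ℂ) (2 * R) := by
    intro z hz
    rw [Metric.mem_ball] at hz hκ
    rw [Metric.mem_closedBall]
    linarith [dist_triangle z κ 0]
  have hmain := posLog_norm_mul_volume_ball_le_lintegral (f := fun z => L t (f z)) (c := κ) (R := R)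
    ((L t).differentiable.comp_differentiableOn (hf.mono (hball.trans hsub)))
  have hvol : volume (Metric.ball κ R) = V := by
    rw [hV, Measure.addHaar_ball_center]
  have h1t : 1 ≤ t ^ (-α) := Real.one_le_rpow_of_pos_of_le_one_of_nonpos ht.1 ht.2 (by linarith)
  have hDt : 1 ≤ D * t ^ (-α) := by nlinarith
  -- On the exceptional set the a priori bound is used, off it the bound m + 1.
  have hbound : ∫⁻ z in Metric.ball κ R, ENNReal.ofReal (log⁺ ‖L t (f z)‖) ≤
      (ENNReal.ofReal (Real.log (m + 1 : ℕ)) +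
        ENNReal.ofReal η * ENNReal.ofReal (Real.log (D * t ^ (-α)))) * V := by
    calc ∫⁻ z in Metric.ball κ R, ENNReal.ofReal (log⁺ ‖L t (f z)‖)
        ≤ ∫⁻ z in Metric.ball κ R, (ENNReal.ofReal (Real.log (m + 1 : ℕ)) +
          (X m).indicator (fun _ => ENNReal.ofReal (Real.log (D * t ^ (-α)))) z) := by
          refine setLIntegral_mono' measurableSet_ball fun z hz => ?_
          by_cases hzX : z ∈ X m
          · rw [indicator_of_mem hzX]
            refine le_add_left (ENNReal.ofReal_le_ofReal ?_)
            rw [← posLog_eq_log (x := D * t ^ (-α)) (by rwa [abs_of_pos (by linarith)])]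
            exact posLog_le_posLog (norm_nonneg _) (hLD z (hball hz) t ht)
          · refine le_add_right (ENNReal.ofReal_le_ofReal ?_)
            have hzΩ : z ∈ Ω m := by
              by_contra h; exact hzX ⟨hball hz, h⟩
            rw [← log_of_nat_eq_posLog]
            exact posLog_le_posLog (norm_nonneg _) (hzΩ.2 t ht)
      _ ≤ ENNReal.ofReal (Real.log (m + 1 : ℕ)) * V +
          ENNReal.ofReal (Real.log (D * t ^ (-α))) * volume (X m) := by
          rw [lintegral_add_left measurable_const, setLIntegral_const, hvol]
          gcongr
          refine (setLIntegral_le_lintegral _ _).trans ?_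
          rw [lintegral_indicator_const (hXmeas m)]
      _ ≤ _ := by
          rw [add_mul]
          refine add_le_add le_rfl ?_
          calc _ ≤ ENNReal.ofReal (Real.log (D * t ^ (-α))) * (ENNReal.ofReal η * V) := by gcongr
            _ = _ := by ring
  rw [hvol] at hmain
  have h3 := (ENNReal.mul_le_mul_iff_left hV0 hVt).1 (hmain.trans hbound)
  have hlm : 0 ≤ Real.log (m + 1 : ℕ) := Real.log_natCast_nonneg _
  have hlD : 0 ≤ Real.log (D * t ^ (-α)) := Real.log_nonneg hDt
  rw [← ENNReal.ofReal_mul hη0.le, ← ENNReal.ofReal_add hlm (by positivity),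
    ENNReal.ofReal_le_ofReal_iff (by positivity)] at h3
  have h4 : max 1 ‖L t (f κ)‖ ≤ (m + 1 : ℕ) * (D * t ^ (-α)) ^ η := by
    rw [← Real.log_le_log_iff (by positivity) (by positivity), ← posLog_eq_log_max_one
      (norm_nonneg _), Real.log_mul (by positivity) (by positivity), Real.log_rpow (by positivity)]
    exact h3
  refine (le_max_right _ _).trans (h4.trans_eq ?_)
  rw [Real.mul_rpow (by positivity) (by positivity), ← Real.rpow_mul ht.1.le,
    show -α * η = -(1 / 2) by rw [hη]; field_simp, mul_assoc]

/-! ### Resolvent identities and the reduced resolvent at a simple pole -/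

namespace UnboundedOp

variable {E : Type*} [NormedAddCommGroup E] [NormedSpace ℂ E] {A : E →ₗ.[ℂ] E}

theorem isResolventAt_resolvent {μ : ℂ} (h : μ ∈ resolventSet A) :
    IsResolventAt A μ (resolvent A μ) := by
  rw [resolvent, dif_pos h]; exact h.choose_spec

namespace IsResolventAt

variable {μ ν : ℂ} {R R' : E →L[ℂ] E}

theorem mem_domain (h : IsResolventAt A μ R) (y : E) : R y ∈ A.domain := (h.1 y).1

theorem apply_eq (h : IsResolventAt A μ R) (y : E) :
    A ⟨R y, h.mem_domain y⟩ = μ • R y - y := by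
  rw [eq_sub_iff_add_eq, ← eq_sub_iff_add_eq', (h.1 y).2]

theorem left_inv (h : IsResolventAt A μ R) (x : A.domain) : R (μ • (x : E) - A x) = x := h.2 x

/-- The resolvent identity. -/
theorem resolvent_identity (h : IsResolventAt A μ R) (h' : IsResolventAt A ν R') :
    R = R' + (ν - μ) • (R * R') := by
  ext y
  have h1 := h.left_inv ⟨R' y, h'.mem_domain y⟩
  rw [h'.apply_eq] at h1
  simp only [add_apply, smul_apply,
    mul_apply_eq_comp]
  rw [sub_sub_eq_add_sub, add_comm (μ • R' y), add_sub_assoc, ← sub_smul, map_add, map_smul] at h1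
  linear_combination (norm := module) h1

theorem resolvent_identity' (h : IsResolventAt A μ R) (h' : IsResolventAt A ν R') :
    R = R' + (ν - μ) • (R' * R) := by
  have := h'.resolvent_identity h
  linear_combination (norm := module) -this

end IsResolventAt

/-- The data of the spectral decomposition at a simple isolated eigenvalue `l` with eigenvector
`v`: the spectral projection is `x ↦ φ x • v`, and `H` is the reduced resolvent. -/
structure IsReducedResolvent (A : E →ₗ.[ℂ] E) (l : ℂ) (v : E) (φ : E →L[ℂ] ℂ) (H : E →L[ℂ] E) :
    Prop where
  mem_domain : ∀ x, H x ∈ A.domain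
  apply_eq : ∀ x, l • H x - A ⟨H x, mem_domain x⟩ = x - φ x • v
  left_inv : ∀ x : A.domain, H (l • (x : E) - A x) = x - φ x • v
  functional_eigenvector : φ v = 1
  functional_range : ∀ x : A.domain, φ (l • (x : E) - A x) = 0
  functional_comp : ∀ x, φ (H x) = 0

theorem kerPow_one (A : E →ₗ.[ℂ] E) (l : ℂ) (x : E) :
    x ∈ kerPow A l 1 ↔ ∃ h : x ∈ A.domain, l • x - A ⟨x, h⟩ = 0 := by
  simp only [kerPow, Submodule.mem_map, Submodule.mem_comap, Submodule.mem_bot]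
  constructor
  · rintro ⟨y, hy, rfl⟩
    exact ⟨y.2, hy⟩
  · rintro ⟨h, hx⟩
    exact ⟨⟨x, h⟩, hx, rfl⟩

theorem mem_kerPow_succ (A : E →ₗ.[ℂ] E) (l : ℂ) (m : ℕ) (x : E) :
    x ∈ kerPow A l (m + 1) ↔ ∃ h : x ∈ A.domain, l • x - A ⟨x, h⟩ ∈ kerPow A l m := by
  simp only [kerPow, Submodule.mem_map, Submodule.mem_comap]
  constructor
  · rintro ⟨y, hy, rfl⟩
    exact ⟨y.2, hy⟩
  · rintro ⟨h, hx⟩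
    exact ⟨⟨x, h⟩, hx, rfl⟩

theorem kerPow_le_genEigenspace (A : E →ₗ.[ℂ] E) (l : ℂ) (m : ℕ) :
    kerPow A l m ≤ genEigenspace A l := le_iSup (kerPow A l) m

theorem IsAlgSimple.exists_smul_eq {l : ℂ} (h : IsAlgSimple A l) {v : E}
    (hv : IsEigenvector A l v) {x : E} (hx : x ∈ genEigenspace A l) : ∃ a : ℂ, x = a • v := by
  have hvm : v ∈ genEigenspace A l := kerPow_le_genEigenspace A l 1 <| by
    rw [kerPow_one]
    obtain ⟨hd, hA⟩ := hv.2
    exact ⟨hd, by rw [hA, sub_self]⟩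
  obtain ⟨a, ha⟩ := (finrank_eq_one_iff_of_nonzero' (⟨v, hvm⟩ : genEigenspace A l)
    (by simpa using hv.1)).1 h.2 ⟨x, hx⟩
  exact ⟨a, by simpa using (congrArg Subtype.val ha).symm⟩

/-- The function g(z) = (z - l)^{k+1} R(z, A) is analytic at l, where k + 1 is the order of the
pole. Evaluating and differentiating the resolvent identity for g at l gives algebraic relations for
P = g(l) and H = g'(l), without contour integrals. Algebraic simplicity forces k = 0; then P is the
spectral projection and H the constant Laurent coefficient. -/
theorem exists_isReducedResolvent {l μ₀ : ℂ} (hμ₀ : μ₀ ∈ resolventSet A)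
    (hpole : IsPoleOfResolvent A l) (hsimple : IsAlgSimple A l) {v : E}
    (hv : IsEigenvector A l v) :
    ∃ (φ : E →L[ℂ] ℂ) (H : E →L[ℂ] E), IsReducedResolvent A l v φ H := by
  obtain ⟨-, hres, hmer, hord⟩ := hpole
  obtain ⟨hv0, hvd, hvA⟩ := hv
  set R := UnboundedOp.resolvent A μ₀ with hRdef
  have hR : IsResolventAt A μ₀ R := isResolventAt_resolvent hμ₀
  obtain ⟨n, hn⟩ := WithTop.ne_top_iff_exists.1 hord.ne_top
  rw [← hn] at hord
  have hn0 : n < 0 := by exact_mod_cast hord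
  obtain ⟨g, hg, hg0, hgev⟩ := (meromorphicOrderAt_eq_int_iff hmer).1 hn.symm
  obtain ⟨k, rfl⟩ : ∃ k : ℕ, n = -(k + 1 : ℤ) := ⟨(-n - 1).toNat, by omega⟩
  have hgR : ∀ᶠ z in 𝓝[≠] l, g z = (z - l) ^ (k + 1) • UnboundedOp.resolvent A z := by
    filter_upwards [hgev, self_mem_nhdsWithin] with z hz hzl
    have hne : z - l ≠ 0 := sub_ne_zero.2 hzl
    rw [hz, smul_smul, ← zpow_natCast, ← zpow_add₀ hne]
    simp
  -- Identities on a punctured neighbourhood extend across l by continuity, and so may be evaluated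
  -- and differentiated at l.
  have hext : ∀ {G : Type _} [NormedAddCommGroup G] [NormedSpace ℂ G] (p q : ℂ → G),
      ContinuousAt p l → ContinuousAt q l → (∀ᶠ z in 𝓝[≠] l, p z = q z) → p =ᶠ[𝓝 l] q := by
    intro G _ _ p q hp hq h
    rw [← ContinuousAt.eventuallyEq_nhds_iff_eventuallyEq_nhdsNE hp hq]
    exact h
  have hgc := hg.continuousAt
  have hgd := hg.differentiableAt.hasDerivAt
  set P := g l with hP
  set H := deriv g l with hH
  have hleft : g =ᶠ[𝓝 l] fun z => (z - l) ^ (k + 1) • R + (μ₀ - z) • (R * g z) := by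
    refine hext _ _ hgc (by fun_prop) ?_
    filter_upwards [hgR, hres] with z hz hzr
    rw [hz, mul_smul_comm, smul_comm (μ₀ - z), ← smul_add]
    exact congrArg _ ((isResolventAt_resolvent hzr).resolvent_identity' hR)
  have hright : g =ᶠ[𝓝 l] fun z => (z - l) ^ (k + 1) • R + (μ₀ - z) • (g z * R) := by
    refine hext _ _ hgc (by fun_prop) ?_
    filter_upwards [hgR, hres] with z hz hzr
    rw [hz, smul_mul_assoc, smul_comm (μ₀ - z), ← smul_add]
    exact congrArg _ ((isResolventAt_resolvent hzr).resolvent_identity hR)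
  have hgv : (fun z => g z v) =ᶠ[𝓝 l] fun z => (z - l) ^ k • v := by
    refine hext _ _ (by fun_prop) (by fun_prop) ?_
    filter_upwards [hgR, hres, self_mem_nhdsWithin] with z hz hzr hzl
    have hne : z - l ≠ 0 := sub_ne_zero.2 hzl
    have h1 := (isResolventAt_resolvent hzr).left_inv ⟨v, hvd⟩
    rw [hvA, ← sub_smul, map_smul] at h1
    rw [hz, smul_apply, pow_succ, mul_smul, h1]
  -- The factor (l - l)^k is kept unevaluated: it is 0 for k > 0 and 1 for k = 0, and both cases are
  -- used.
  have hpowd : HasDerivAt (fun z : ℂ => (z - l) ^ (k + 1)) ((k + 1 : ℕ) * (l - l) ^ k) l := by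
    simpa using ((hasDerivAt_id l).sub_const l).fun_pow (k + 1)
  have hsubd : HasDerivAt (fun z : ℂ => μ₀ - z) (-1) l := by
    simpa using (hasDerivAt_id l).const_sub μ₀
  have hP1 : P = (μ₀ - l) • (R * P) := by simpa [← hP] using hleft.eq_of_nhds
  have hP2 : P = (μ₀ - l) • (P * R) := by simpa [← hP] using hright.eq_of_nhds
  have hH1 : H = ((k + 1 : ℕ) * (l - l) ^ k : ℂ) • R + ((μ₀ - l) • (R * H) + (-1 : ℂ) • (R * P)) := by
    refine (hgd.congr_of_eventuallyEq hleft.symm).unique ((hpowd.smul_const R).add ?_)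
    exact hsubd.smul ((hgd.const_mul R))
  have hH2 : H = ((k + 1 : ℕ) * (l - l) ^ k : ℂ) • R + ((μ₀ - l) • (H * R) + (-1 : ℂ) • (P * R)) := by
    refine (hgd.congr_of_eventuallyEq hright.symm).unique ((hpowd.smul_const R).add ?_)
    exact hsubd.smul ((hgd.mul_const R))
  have hRange : ∀ {X Y : E}, X = R Y → ∃ h : X ∈ A.domain, A ⟨X, h⟩ = μ₀ • X - Y := by
    rintro _ Y rfl
    exact ⟨hR.mem_domain Y, hR.apply_eq Y⟩
  have hPx : ∀ x, ∃ h : P x ∈ A.domain, l • P x - A ⟨P x, h⟩ = 0 := by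
    intro x
    have h1 : P x = R ((μ₀ - l) • P x) := by
      conv_lhs => rw [hP1]
      simp
    obtain ⟨h, hA⟩ := hRange h1
    exact ⟨h, by rw [hA]; module⟩
  -- For k > 0 one gets (l - A)Hx = -Px and (l - A)Px = 0. Hence Hx lies in the generalised
  -- eigenspace, which is spanned by the eigenvector v, so Px = 0 for all x, contradicting g(l) ≠ 0.
  have hk : k = 0 := by
    by_contra hk
    apply hg0
    have hk' : (l - l) ^ k = 0 := by simp [hk]
    ext x
    have h1 : H x = R ((μ₀ - l) • H x - P x) := by
      conv_lhs => rw [hH1, hk']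
      simp [sub_eq_add_neg]
    obtain ⟨h, hA⟩ := hRange h1
    have h2 : l • H x - A ⟨H x, h⟩ = - P x := by rw [hA]; module
    have h3 : H x ∈ kerPow A l 2 := by
      rw [mem_kerPow_succ]
      refine ⟨h, ?_⟩
      rw [h2]
      exact Submodule.neg_mem _ ((kerPow_one A l _).2 (hPx x))
    obtain ⟨a, ha⟩ := hsimple.exists_smul_eq ⟨hv0, hvd, hvA⟩ (kerPow_le_genEigenspace A l 2 h3)
    have h4 : A ⟨H x, h⟩ = l • H x := by
      have : (⟨H x, h⟩ : A.domain) = a • ⟨v, hvd⟩ := Subtype.ext ha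
      rw [this, LinearPMap.map_smul, hvA, ha, smul_comm]
    rw [h4, sub_self] at h2
    simpa using h2.symm
  subst hk
  have hPv : P v = v := by simpa [← hP] using hgv.eq_of_nhds
  have hHv : H v = 0 := by
    have h1 : HasDerivAt (fun z => g z v) (H v) l := by
      simpa using hgd.clm_apply (hasDerivAt_const l v)
    have h2 := h1.congr_of_eventuallyEq hgv.symm
    simp only [pow_zero, one_smul] at h2
    exact h2.unique (hasDerivAt_const l v)
  -- P has range in the span of v, so ψ ∘ P with ψ v = 1 is the coefficient functional.
  obtain ⟨ψ, hψ⟩ := SeparatingDual.exists_eq_one (R := ℂ) hv0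
  have hPφ : ∀ x, P x = ψ (P x) • v := by
    intro x
    obtain ⟨a, ha⟩ := hsimple.exists_smul_eq ⟨hv0, hvd, hvA⟩
      (kerPow_le_genEigenspace A l 1 ((kerPow_one A l _).2 (hPx x)))
    rw [ha, map_smul, hψ, smul_eq_mul, mul_one]
  have hHx : ∀ x, H x = R ((x - P x) + (μ₀ - l) • H x) := by
    intro x
    conv_lhs => rw [hH1]
    simp [sub_eq_add_neg]; abel
  have hdom : ∀ x, H x ∈ A.domain := fun x => (hRange (hHx x)).1
  have happ : ∀ x, l • H x - A ⟨H x, hdom x⟩ = x - P x := by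
    intro x
    obtain ⟨h, hA⟩ := hRange (hHx x)
    rw [hA]; module
  have hpre : ∀ x : A.domain, ∃ y, (x : E) = R y ∧ l • (x : E) - A x = y + (l - μ₀) • R y := by
    intro x
    refine ⟨μ₀ • (x : E) - A x, (hR.left_inv x).symm, ?_⟩
    rw [hR.left_inv]; module
  have hleftinv : ∀ x : A.domain, H (l • (x : E) - A x) = x - P x := by
    intro x
    obtain ⟨y, hy, hy'⟩ := hpre x
    have h1 : H y = R y + (μ₀ - l) • H (R y) - P (R y) := by
      conv_lhs => rw [hH2]
      simp [sub_eq_add_neg]; abel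
    rw [hy', hy, map_add, map_smul, h1]; module
  have hPker : ∀ x : A.domain, P (l • (x : E) - A x) = 0 := by
    intro x
    obtain ⟨y, hy, hy'⟩ := hpre x
    have h1 : P y = (μ₀ - l) • P (R y) := by
      conv_lhs => rw [hP2]
      simp
    rw [hy', map_add, map_smul, h1]; module
  -- Apply the left inverse relation to Hx: since (l - A)Hx = x - Px and H annihilates Px, it reads
  -- Hx = Hx - PHx.
  have hPH : ∀ x, P (H x) = 0 := by
    intro x
    have h1 := hleftinv ⟨H x, hdom x⟩
    rw [happ, map_sub, hPφ x, map_smul, hHv, smul_zero, sub_zero] at h1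
    simpa using h1.symm
  refine ⟨ψ.comp P, H, hdom, fun x => ?_, fun x => ?_, ?_, fun x => ?_, fun x => ?_⟩
  · rw [happ, ContinuousLinearMap.comp_apply, ← hPφ]
  · rw [hleftinv, ContinuousLinearMap.comp_apply, ← hPφ]
  · rw [ContinuousLinearMap.comp_apply, hPv, hψ]
  · rw [ContinuousLinearMap.comp_apply, hPker, map_zero]
  · rw [ContinuousLinearMap.comp_apply, hPH, map_zero]

end UnboundedOp

/-! ### Strongly holomorphic operator families and holomorphic fixed points -/

section Holomorphic

variable {E G : Type*} [NormedAddCommGroup E] [NormedSpace ℂ E] [NormedAddCommGroup G]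
  [NormedSpace ℂ G]

/-- A strongly holomorphic operator family vanishing at the centre is `O(κ)` in operator norm. -/
theorem exists_norm_le_mul_norm_of_strongly_holomorphic [CompleteSpace E] {b : ℂ → E →L[ℂ] G}
    (hb : ∀ x, DifferentiableOn ℂ (fun κ => b κ x) (Metric.ball 0 1)) (hb0 : b 0 = 0) :
    ∃ M : ℝ, 0 ≤ M ∧ ∀ κ ∈ Metric.ball (0 : ℂ) (1 / 2), ‖b κ‖ ≤ M * ‖κ‖ := by
  -- Orbits are bounded on a compact disc, hence the operator norms are; the Schwarz lemma for each
  -- κ ↦ b κ x then gives the linear decay at 0.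
  obtain ⟨C, hC⟩ := banach_steinhaus (g := fun κ : Metric.closedBall (0 : ℂ) (1 / 2) => b κ)
    fun x => by
      obtain ⟨C, hC⟩ := (isCompact_closedBall (0 : ℂ) (1 / 2)).exists_bound_of_continuousOn
        ((hb x).continuousOn.mono (Metric.closedBall_subset_ball (by norm_num)))
      exact ⟨C, fun κ => hC κ κ.2⟩
  have hC0 : 0 ≤ C := (norm_nonneg _).trans (hC ⟨0, by simp⟩)
  refine ⟨C / (1 / 2), by positivity, fun κ hκ => ?_⟩
  refine ContinuousLinearMap.opNorm_le_bound _ (by positivity) fun x => ?_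
  have h := Complex.dist_le_div_mul_dist_of_mapsTo_ball (f := fun κ => b κ x) (c := 0)
    (R₁ := 1 / 2) (R₂ := C * ‖x‖) (z := κ)
    ((hb x).mono (Metric.ball_subset_ball (by norm_num))) (fun w hw => by
      rw [hb0]
      simpa using (b w).le_of_opNorm_le (hC ⟨w, Metric.ball_subset_closedBall hw⟩) x) hκ
  simp only [hb0, zero_apply, dist_zero_right] at h
  refine h.trans_eq (by ring)

/-- Product rule for a strongly holomorphic bounded operator family. -/
theorem differentiableOn_clm_apply_of_strongly_holomorphic {b : ℂ → E →L[ℂ] G} {ρ C : ℝ}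
    (hb : ∀ x, DifferentiableOn ℂ (fun κ => b κ x) (Metric.ball 0 ρ))
    (hC : ∀ κ ∈ Metric.ball (0 : ℂ) ρ, ‖b κ‖ ≤ C) {z : ℂ → E}
    (hz : DifferentiableOn ℂ z (Metric.ball 0 ρ)) :
    DifferentiableOn ℂ (fun κ => b κ (z κ)) (Metric.ball 0 ρ) := by
  intro κ hκ
  have hnhds := Metric.isOpen_ball.mem_nhds hκ
  have hzd := ((hz κ hκ).differentiableAt hnhds).hasDerivAt
  have hbd := ((hb (z κ) κ hκ).differentiableAt hnhds).hasDerivAt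
  refine DifferentiableAt.differentiableWithinAt (HasDerivAt.differentiableAt
    (f' := b κ (deriv z κ) + deriv (fun w => b w (z κ)) κ) ?_)
  rw [hasDerivAt_iff_tendsto_slope] at hzd hbd ⊢
  have hev : ∀ᶠ w in 𝓝[≠] κ, w ∈ Metric.ball (0 : ℂ) ρ := nhdsWithin_le_nhds hnhds
  -- Only the uniform bound on ‖b w‖ is needed here; norm continuity of the family plays no role.
  have h1 : Tendsto (fun w => b w (slope z κ w - deriv z κ)) (𝓝[≠] κ) (𝓝 0) := by
    refine squeeze_zero_norm' (a := fun w => C * ‖slope z κ w - deriv z κ‖) ?_ ?_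
    · filter_upwards [hev] with w hw
      exact (b w).le_of_opNorm_le (hC w hw) _
    · have := (hzd.sub_const (deriv z κ)).norm.const_mul C
      simpa using this
  have h2 : Tendsto (fun w => b w (deriv z κ)) (𝓝[≠] κ) (𝓝 (b κ (deriv z κ))) :=
    (((hb (deriv z κ)).continuousOn.continuousAt hnhds)).tendsto.mono_left nhdsWithin_le_nhds
  have h3 := (h1.add h2).add hbd
  rw [zero_add] at h3
  refine h3.congr fun w => ?_
  simp only [slope, vsub_eq_sub, map_sub, map_smul]
  module

/-- The fixed points of a holomorphic family of contractions of the unit ball depend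
holomorphically on the parameter. -/
theorem exists_holomorphic_fixedPoint [CompleteSpace E] {Φ : ℂ → E → E} {ρ : ℝ}
    (hmaps : ∀ κ ∈ Metric.ball (0 : ℂ) ρ, ∀ z, ‖z‖ ≤ 1 → ‖Φ κ z‖ ≤ 1)
    (hlip : ∀ κ ∈ Metric.ball (0 : ℂ) ρ, ∀ z w, ‖z‖ ≤ 1 → ‖w‖ ≤ 1 →
      ‖Φ κ z - Φ κ w‖ ≤ 1 / 2 * ‖z - w‖)
    (hhol : ∀ z : ℂ → E, DifferentiableOn ℂ z (Metric.ball 0 ρ) →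
      DifferentiableOn ℂ (fun κ => Φ κ (z κ)) (Metric.ball 0 ρ)) :
    ∃ z : ℂ → E, DifferentiableOn ℂ z (Metric.ball 0 ρ) ∧
      ∀ κ ∈ Metric.ball (0 : ℂ) ρ, ‖z κ‖ ≤ 1 ∧ Φ κ (z κ) = z κ := by
  -- Picard iterates starting from 0; each is holomorphic, and they converge uniformly on the ball,
  -- so the limit is holomorphic.
  let s : ℕ → ℂ → E := fun n => Nat.rec (fun _ => 0) (fun _ f κ => Φ κ (f κ)) n
  have hs : ∀ n κ, s (n + 1) κ = Φ κ (s n κ) := fun _ _ => rfl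
  have hs1 : ∀ n, ∀ κ ∈ Metric.ball (0 : ℂ) ρ, ‖s n κ‖ ≤ 1 := by
    intro n
    induction n with
    | zero => intro κ _; simp [s]
    | succ n ih => intro κ hκ; exact hmaps κ hκ _ (ih κ hκ)
  have hsd : ∀ n, DifferentiableOn ℂ (s n) (Metric.ball 0 ρ) := by
    intro n
    induction n with
    | zero => exact differentiableOn_const _
    | succ n ih => exact hhol _ ih
  have hdist : ∀ κ ∈ Metric.ball (0 : ℂ) ρ, ∀ n, dist (s n κ) (s (n + 1) κ) ≤ 1 * (1 / 2) ^ n := by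
    intro κ hκ n
    induction n with
    | zero =>
      rw [dist_comm, dist_eq_norm]
      simpa [s] using hs1 1 κ hκ
    | succ n ih =>
      rw [hs (n + 1), hs n, dist_eq_norm, pow_succ']
      rw [dist_eq_norm, hs] at ih
      refine (hlip κ hκ _ _ (hs1 n κ hκ) ?_).trans (by linarith)
      exact hs1 (n + 1) κ hκ
  have hlim : ∀ κ, ∃ y, κ ∈ Metric.ball (0 : ℂ) ρ → Tendsto (fun n => s n κ) atTop (𝓝 y) := by
    intro κ
    by_cases hκ : κ ∈ Metric.ball (0 : ℂ) ρ
    · obtain ⟨y, hy⟩ := cauchySeq_tendsto_of_complete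
        (cauchySeq_of_le_geometric _ 1 (by norm_num) (hdist κ hκ))
      exact ⟨y, fun _ => hy⟩
    · exact ⟨0, fun h => absurd h hκ⟩
  choose z hz using hlim
  have hz1 : ∀ κ ∈ Metric.ball (0 : ℂ) ρ, ‖z κ‖ ≤ 1 := fun κ hκ =>
    le_of_tendsto' (hz κ hκ).norm fun n => hs1 n κ hκ
  have hunif : TendstoUniformlyOn s z atTop (Metric.ball 0 ρ) := by
    rw [Metric.tendstoUniformlyOn_iff]
    intro ε hε
    have h0 : Tendsto (fun n : ℕ => 1 * (1 / 2 : ℝ) ^ n / (1 - 1 / 2)) atTop (𝓝 0) := by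
      simpa using ((tendsto_pow_atTop_nhds_zero_of_lt_one (r := (1 / 2 : ℝ)) (by norm_num)
        (by norm_num)).div_const (1 - 1 / 2))
    filter_upwards [h0.eventually_lt_const hε] with n hn κ hκ
    rw [dist_comm]
    exact (dist_le_of_le_geometric_of_tendsto _ _ (by norm_num) (hdist κ hκ) (hz κ hκ) n).trans_lt
      hn
  refine ⟨z, hunif.tendstoLocallyUniformlyOn.differentiableOn (Eventually.of_forall hsd)
    Metric.isOpen_ball, fun κ hκ => ⟨hz1 κ hκ, ?_⟩⟩
  have h1 : Tendsto (fun n => Φ κ (s n κ)) atTop (𝓝 (z κ)) := by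
    simpa [hs] using (tendsto_add_atTop_iff_nat 1).2 (hz κ hκ)
  refine tendsto_nhds_unique ?_ h1
  rw [tendsto_iff_norm_sub_tendsto_zero]
  have h2 := (tendsto_iff_norm_sub_tendsto_zero.1 (hz κ hκ)).const_mul (1 / 2)
  rw [mul_zero] at h2
  exact squeeze_zero (fun _ => norm_nonneg _)
    (fun n => hlip κ hκ _ _ (hs1 n κ hκ) (hz1 κ hκ)) h2

end Holomorphic

/-! ### Eigenvectors of the perturbed operator as fixed points -/

namespace UnboundedOp

variable {E : Type*} [NormedAddCommGroup E] [NormedSpace ℂ E]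

/-- The map whose fixed points are the vectors `(l - A) v` for the normalised eigenvectors `v` of
the perturbed operator. -/
noncomputable def eigenMap (φ : E →L[ℂ] ℂ) (H J : E →L[ℂ] E) (v y : E) (b : E →L[ℂ] E) (z : E) : E :=
  b (y + J z) - φ (b (y + J z)) • (v + H z)

/-- The size of the data of `eigenMap`. -/
noncomputable def eigenConst (φ : E →L[ℂ] ℂ) (H J : E →L[ℂ] E) (v y : E) : ℝ :=
  (‖y‖ + ‖J‖) * (1 + ‖φ‖ * (‖v‖ + ‖H‖))

section EigenMap

variable {φ : E →L[ℂ] ℂ} {H J : E →L[ℂ] E} {v y : E} {b : E →L[ℂ] E}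

theorem eigenConst_nonneg : 0 ≤ eigenConst φ H J v y := by
  unfold eigenConst; positivity

theorem norm_add_apply_le (T : E →L[ℂ] E) (x : E) {z : E} (hz : ‖z‖ ≤ 1) :
    ‖x + T z‖ ≤ ‖x‖ + ‖T‖ :=
  (norm_add_le _ _).trans (by gcongr; exact (T.le_opNorm z).trans (mul_le_of_le_one_right
    (norm_nonneg _) hz))

theorem norm_eigenMap_le (hb : 4 * (‖b‖ * eigenConst φ H J v y) ≤ 1) {z : E} (hz : ‖z‖ ≤ 1) :
    ‖eigenMap φ H J v y b z‖ ≤ 1 := by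
  have h1 : ‖b (y + J z)‖ ≤ ‖b‖ * (‖y‖ + ‖J‖) :=
    (b.le_opNorm _).trans (by gcongr; exact norm_add_apply_le J y hz)
  have h2 : ‖φ (b (y + J z)) • (v + H z)‖ ≤ ‖φ‖ * (‖b‖ * (‖y‖ + ‖J‖)) * (‖v‖ + ‖H‖) := by
    rw [norm_smul]
    gcongr
    · exact (φ.le_opNorm _).trans (by gcongr)
    · exact norm_add_apply_le H v hz
  have h3 : ‖b‖ * (‖y‖ + ‖J‖) + ‖φ‖ * (‖b‖ * (‖y‖ + ‖J‖)) * (‖v‖ + ‖H‖) =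
      ‖b‖ * eigenConst φ H J v y := by unfold eigenConst; ring
  have h4 := mul_nonneg (norm_nonneg b) (eigenConst_nonneg (φ := φ) (H := H) (J := J) (v := v)
    (y := y))
  refine (norm_sub_le _ _).trans ((add_le_add h1 h2).trans ?_)
  rw [h3]; linarith

/-- The variable z occurs in both factors of the product term, so the Lipschitz constant is bounded
by 2 ‖b‖ `eigenConst`; this is what the factor 4 in the smallness condition pays for. -/
theorem norm_eigenMap_sub_le (hb : 4 * (‖b‖ * eigenConst φ H J v y) ≤ 1) {z w : E}
    (hz : ‖z‖ ≤ 1) (hw : ‖w‖ ≤ 1) :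
    ‖eigenMap φ H J v y b z - eigenMap φ H J v y b w‖ ≤ 1 / 2 * ‖z - w‖ := by
  have h0 : eigenMap φ H J v y b z - eigenMap φ H J v y b w = b (J (z - w)) -
      (φ (b (J (z - w))) • (v + H z) + φ (b (y + J w)) • H (z - w)) := by
    simp only [eigenMap, map_add, map_sub]
    module
  have h1 : ‖b (J (z - w))‖ ≤ ‖b‖ * (‖J‖ * ‖z - w‖) :=
    (b.le_opNorm _).trans (by gcongr; exact J.le_opNorm _)
  have h2 : ‖φ (b (J (z - w))) • (v + H z)‖ ≤ ‖φ‖ * (‖b‖ * (‖J‖ * ‖z - w‖)) * (‖v‖ + ‖H‖) := by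
    rw [norm_smul]
    gcongr
    · exact (φ.le_opNorm _).trans (by gcongr)
    · exact norm_add_apply_le H v hz
  have h3 : ‖φ (b (y + J w)) • H (z - w)‖ ≤ ‖φ‖ * (‖b‖ * (‖y‖ + ‖J‖)) * (‖H‖ * ‖z - w‖) := by
    rw [norm_smul]
    gcongr
    · refine (φ.le_opNorm _).trans ?_
      gcongr
      exact (b.le_opNorm _).trans (by gcongr; exact norm_add_apply_le J y hw)
    · exact H.le_opNorm _
  rw [h0]
  refine (norm_sub_le _ _).trans ((add_le_add h1 ((norm_add_le _ _).trans
    (add_le_add h2 h3))).trans ?_)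
  have h4 : ‖b‖ * (‖J‖ * ‖z - w‖) + (‖φ‖ * (‖b‖ * (‖J‖ * ‖z - w‖)) * (‖v‖ + ‖H‖) +
      ‖φ‖ * (‖b‖ * (‖y‖ + ‖J‖)) * (‖H‖ * ‖z - w‖)) =
      ‖b‖ * (‖J‖ + ‖φ‖ * ‖J‖ * (‖v‖ + ‖H‖) + ‖φ‖ * (‖y‖ + ‖J‖) * ‖H‖) * ‖z - w‖ := by ring
  have h5 : ‖J‖ + ‖φ‖ * ‖J‖ * (‖v‖ + ‖H‖) + ‖φ‖ * (‖y‖ + ‖J‖) * ‖H‖ ≤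
      2 * eigenConst φ H J v y := by
    have : 2 * eigenConst φ H J v y - (‖J‖ + ‖φ‖ * ‖J‖ * (‖v‖ + ‖H‖) + ‖φ‖ * (‖y‖ + ‖J‖) * ‖H‖) =
      2 * ‖y‖ + ‖J‖ + 2 * (‖y‖ * ‖φ‖ * ‖v‖) + ‖y‖ * ‖φ‖ * ‖H‖ + ‖J‖ * ‖φ‖ * ‖v‖ := by
        unfold eigenConst; ring
    have h6 : 0 ≤ 2 * ‖y‖ + ‖J‖ + 2 * (‖y‖ * ‖φ‖ * ‖v‖) + ‖y‖ * ‖φ‖ * ‖H‖ + ‖J‖ * ‖φ‖ * ‖v‖ := by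
      positivity
    linarith
  rw [h4]
  gcongr
  calc _ ≤ ‖b‖ * (2 * eigenConst φ H J v y) := by gcongr
    _ ≤ _ := by linarith

theorem eigenMap_fixedPoint_unique (hb : 4 * (‖b‖ * eigenConst φ H J v y) ≤ 1) {z w : E}
    (hz : ‖z‖ ≤ 1) (hw : ‖w‖ ≤ 1) (hz' : eigenMap φ H J v y b z = z)
    (hw' : eigenMap φ H J v y b w = w) : z = w := by
  have h := norm_eigenMap_sub_le hb hz hw
  rw [hz', hw'] at h
  have : ‖z - w‖ ≤ 0 := by linarith
  exact sub_eq_zero.1 (norm_le_zero_iff.1 this)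

/-- The shift φ(b(y + Jz)) of the eigenvalue lies in the range in which the uniqueness and
simplicity lemmas below apply. -/
theorem norm_functional_mul_le (hb : 4 * (‖b‖ * eigenConst φ H J v y) ≤ 1) {z : E}
    (hz : ‖z‖ ≤ 1) : ‖φ (b (y + J z))‖ * (‖v‖ + ‖H‖) ≤ 1 / 4 := by
  have h1 : ‖φ (b (y + J z))‖ ≤ ‖φ‖ * (‖b‖ * (‖y‖ + ‖J‖)) := by
    refine (φ.le_opNorm _).trans ?_
    gcongr
    exact (b.le_opNorm _).trans (by gcongr; exact norm_add_apply_le J y hz)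
  have h2 : ‖φ (b (y + J z))‖ * (‖v‖ + ‖H‖) ≤ ‖φ‖ * (‖b‖ * (‖y‖ + ‖J‖)) * (‖v‖ + ‖H‖) := by
    gcongr
  have h3 : ‖b‖ * eigenConst φ H J v y = ‖b‖ * (‖y‖ + ‖J‖) +
      ‖φ‖ * (‖b‖ * (‖y‖ + ‖J‖)) * (‖v‖ + ‖H‖) := by unfold eigenConst; ring
  have h4 : 0 ≤ ‖b‖ * (‖y‖ + ‖J‖) := by positivity
  linarith

end EigenMap

/-- The operator `(μ₀ - A) H` for a reduced resolvent `H`. -/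
noncomputable def reducedComp (l μ₀ : ℂ) (v : E) (φ : E →L[ℂ] ℂ) (H : E →L[ℂ] E) : E →L[ℂ] E :=
  (μ₀ - l) • H + ContinuousLinearMap.id ℂ E - φ.smulRight v

section Perturbation

variable {A : E →ₗ.[ℂ] E} {B : A.domain →ₗ[ℂ] E} {l μ₀ : ℂ} {v₀ : E} {φ : E →L[ℂ] ℂ}
  {H : E →L[ℂ] E} {b : E →L[ℂ] E}

theorem perturb_apply (x : E) (hx : x ∈ A.domain) :
    perturb A B ⟨x, hx⟩ = A ⟨x, hx⟩ + B ⟨x, hx⟩ := rfl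

/-- `B` on vectors of the form `a • v₀ + H z`. -/
theorem IsReducedResolvent.perturbation_apply (hH : IsReducedResolvent A l v₀ φ H)
    (hv₀ : IsEigenvector A l v₀)
    (hb : ∀ x : A.domain, B x = b (μ₀ • (x : E) - A x)) (a : ℂ) (z : E) :
    ∃ h : a • v₀ + H z ∈ A.domain,
      l • (a • v₀ + H z) - A ⟨a • v₀ + H z, h⟩ = z - φ z • v₀ ∧
      B ⟨a • v₀ + H z, h⟩ = b (a • ((μ₀ - l) • v₀) + reducedComp l μ₀ v₀ φ H z) := by
  obtain ⟨-, hd, hA⟩ := hv₀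
  have h : a • v₀ + H z ∈ A.domain :=
    A.domain.add_mem (A.domain.smul_mem a hd) (hH.mem_domain z)
  have hAv : A ⟨a • v₀ + H z, h⟩ = a • (l • v₀) + A ⟨H z, hH.mem_domain z⟩ := by
    rw [← hA, ← LinearPMap.map_smul, ← LinearPMap.map_add]
    rfl
  have h1 := hH.apply_eq z
  refine ⟨h, ?_, ?_⟩
  · rw [hAv, ← h1]; module
  · rw [hb, hAv]
    congr 1
    simp only [reducedComp, add_apply, sub_apply, smul_apply, ContinuousLinearMap.id_apply,
      ContinuousLinearMap.smulRight_apply]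
    linear_combination (norm := module) h1

theorem IsReducedResolvent.decomposition (hH : IsReducedResolvent A l v₀ φ H) (x : A.domain) :
    (x : E) = φ x • v₀ + H (l • (x : E) - A x) := by
  rw [hH.left_inv]; abel

/-- A fixed point of `eigenMap` yields an eigenvector of `A + B`. -/
theorem IsReducedResolvent.eigenvector_of_fixedPoint (hH : IsReducedResolvent A l v₀ φ H)
    (hv₀ : IsEigenvector A l v₀) (hb : ∀ x : A.domain, B x = b (μ₀ • (x : E) - A x)) {z : E}
    (hz : eigenMap φ H (reducedComp l μ₀ v₀ φ H) v₀ ((μ₀ - l) • v₀) b z = z) :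
    φ (v₀ + H z) = 1 ∧ ∃ h : v₀ + H z ∈ A.domain,
      B ⟨v₀ + H z, h⟩ = b ((μ₀ - l) • v₀ + reducedComp l μ₀ v₀ φ H z) ∧
      A ⟨v₀ + H z, h⟩ + B ⟨v₀ + H z, h⟩ =
        (l + φ (b ((μ₀ - l) • v₀ + reducedComp l μ₀ v₀ φ H z))) • (v₀ + H z) := by
  have h1 : φ (v₀ + H z) = 1 := by
    rw [map_add, hH.functional_eigenvector, hH.functional_comp, add_zero]
  obtain ⟨h, hA, hB⟩ := hH.perturbation_apply hv₀ hb 1 z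
  simp only [one_smul] at h hA hB
  refine ⟨h1, h, hB, ?_⟩
  set β := b ((μ₀ - l) • v₀ + reducedComp l μ₀ v₀ φ H z) with hβ
  have hzβ : z = β - φ β • (v₀ + H z) := hz.symm
  -- φ applied to the fixed point equation gives φ z = 0, since φ(v₀ + Hz) = 1. Thus (l - A)(v₀ +
  -- Hz) is z itself, without a correction along v₀.
  have hφz : φ z = 0 := by
    rw [hzβ, map_sub, map_smul, h1]; simp
  rw [hφz, zero_smul, sub_zero] at hA
  rw [hB]
  linear_combination (norm := module) -hA - hzβ

/-- A normalised eigenvector of `A + B` close to `v₀` is given by a fixed point of `eigenMap`. -/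
theorem IsReducedResolvent.fixedPoint_of_eigenvector (hH : IsReducedResolvent A l v₀ φ H)
    (hv₀ : IsEigenvector A l v₀) (hb : ∀ x : A.domain, B x = b (μ₀ • (x : E) - A x))
    (hsmall : 4 * (‖b‖ * eigenConst φ H (reducedComp l μ₀ v₀ φ H) v₀ ((μ₀ - l) • v₀)) ≤ 1)
    {μ : ℂ} (hμ : ‖μ‖ * (‖v₀‖ + ‖H‖) ≤ 1 / 4) {v : E} (hφ : φ v = 1) (hv : v ∈ A.domain)
    (heig : A ⟨v, hv⟩ + B ⟨v, hv⟩ = (l + μ) • v) :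
    ∃ z, ‖z‖ ≤ 1 ∧ eigenMap φ H (reducedComp l μ₀ v₀ φ H) v₀ ((μ₀ - l) • v₀) b z = z ∧
      v = v₀ + H z ∧ μ = φ (b ((μ₀ - l) • v₀ + reducedComp l μ₀ v₀ φ H z)) := by
  set J := reducedComp l μ₀ v₀ φ H
  set y := (μ₀ - l) • v₀
  set z := l • v - A ⟨v, hv⟩ with hzdef
  have hvz : v = v₀ + H z := by
    have := hH.decomposition ⟨v, hv⟩
    rw [hφ, one_smul] at this
    exact this
  have hφz : φ z = 0 := hH.functional_range ⟨v, hv⟩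
  have hB : B ⟨v, hv⟩ = b (y + J z) := by
    obtain ⟨h, -, hB⟩ := hH.perturbation_apply hv₀ hb 1 z
    simp only [one_smul] at hB
    rw [← hB]
    congr 1
    exact Subtype.ext hvz
  have hz1 : z = b (y + J z) - μ • v := by
    rw [← hB, hzdef]
    linear_combination (norm := module) -heig
  have hμβ : μ = φ (b (y + J z)) := by
    have := congrArg φ hz1
    rw [hφz, map_sub, map_smul, hφ, smul_eq_mul, mul_one] at this
    exact (sub_eq_zero.1 this.symm).symm
  have hzn : ‖z‖ ≤ 1 := by
    have e1 : ‖b (y + J z)‖ ≤ ‖b‖ * (‖y‖ + ‖J‖ * ‖z‖) := by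
      refine (b.le_opNorm _).trans ?_
      gcongr
      exact (norm_add_le _ _).trans (by gcongr; exact J.le_opNorm z)
    have e2 : ‖μ • v‖ ≤ ‖μ‖ * (‖v₀‖ + ‖H‖ * ‖z‖) := by
      rw [norm_smul]
      gcongr
      rw [hvz]
      exact (norm_add_le _ _).trans (by gcongr; exact H.le_opNorm z)
    have e3 : ‖z‖ ≤ ‖b‖ * (‖y‖ + ‖J‖ * ‖z‖) + ‖μ‖ * (‖v₀‖ + ‖H‖ * ‖z‖) := by
      conv_lhs => rw [hz1]
      exact (norm_sub_le _ _).trans (add_le_add e1 e2)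
    have e4 : ‖b‖ * (‖y‖ + ‖J‖) ≤ 1 / 4 := by
      have : ‖b‖ * eigenConst φ H J v₀ y = ‖b‖ * (‖y‖ + ‖J‖) +
        ‖φ‖ * (‖b‖ * (‖y‖ + ‖J‖)) * (‖v₀‖ + ‖H‖) := by unfold eigenConst; ring
      have h4 : 0 ≤ ‖φ‖ * (‖b‖ * (‖y‖ + ‖J‖)) * (‖v₀‖ + ‖H‖) := by positivity
      linarith
    -- If ‖z‖ > 1, the constant terms can be absorbed into multiples of ‖z‖, and the bound becomes
    -- ‖z‖ ≤ ‖z‖/2.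
    by_contra hcon
    push Not at hcon
    have e5 : ‖b‖ * (‖y‖ + ‖J‖ * ‖z‖) ≤ ‖b‖ * (‖y‖ + ‖J‖) * ‖z‖ := by
      rw [mul_assoc, add_mul]
      gcongr
      exact le_mul_of_one_le_right (norm_nonneg _) hcon.le
    have e6 : ‖μ‖ * (‖v₀‖ + ‖H‖ * ‖z‖) ≤ ‖μ‖ * (‖v₀‖ + ‖H‖) * ‖z‖ := by
      rw [mul_assoc, add_mul]
      gcongr
      exact le_mul_of_one_le_right (norm_nonneg _) hcon.le
    have e7 : ‖b‖ * (‖y‖ + ‖J‖) * ‖z‖ ≤ 1 / 4 * ‖z‖ := by gcongr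
    have e8 : ‖μ‖ * (‖v₀‖ + ‖H‖) * ‖z‖ ≤ 1 / 4 * ‖z‖ := by gcongr
    linarith
  refine ⟨z, hzn, ?_, hvz, hμβ⟩
  rw [eigenMap, ← hμβ, ← hvz, ← hz1]

/-- Near `l`, the operator `A + B - (l + μ)` has trivial Jordan structure. -/
theorem IsReducedResolvent.eq_smul_of_sub_apply_eq (hH : IsReducedResolvent A l v₀ φ H)
    (hv₀ : IsEigenvector A l v₀) (hb : ∀ x : A.domain, B x = b (μ₀ • (x : E) - A x))
    (hsmall : 4 * (‖b‖ * eigenConst φ H (reducedComp l μ₀ v₀ φ H) v₀ ((μ₀ - l) • v₀)) ≤ 1)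
    {μ : ℂ} (hμ : ‖μ‖ * (‖v₀‖ + ‖H‖) ≤ 1 / 4) {v : E} (hφ : φ v = 1) (hv : v ∈ A.domain)
    (heig : A ⟨v, hv⟩ + B ⟨v, hv⟩ = (l + μ) • v) (hvn : ‖v‖ ≤ ‖v₀‖ + ‖H‖)
    {x : E} (hx : x ∈ A.domain) {a : ℂ}
    (hxa : (l + μ) • x - (A ⟨x, hx⟩ + B ⟨x, hx⟩) = a • v) : x = φ x • v := by
  set J := reducedComp l μ₀ v₀ φ H
  -- Subtracting φ x • v moves to the kernel of φ without changing the right side a • v. There w =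
  -- Hz, and the equation for z has a right side of norm at most ‖z‖/2.
  have hwd : x - φ x • v ∈ A.domain := A.domain.sub_mem hx (A.domain.smul_mem _ hv)
  set w : A.domain := ⟨x - φ x • v, hwd⟩ with hw
  have hw' : w = ⟨x, hx⟩ - φ x • ⟨v, hv⟩ := rfl
  have hφw : φ w = 0 := by
    rw [hw, map_sub, map_smul, hφ, smul_eq_mul, mul_one, sub_self]
  have hAw : A w = A ⟨x, hx⟩ - φ x • A ⟨v, hv⟩ := by
    rw [hw', LinearPMap.map_sub, LinearPMap.map_smul]
  have hBw : B w = B ⟨x, hx⟩ - φ x • B ⟨v, hv⟩ := by rw [hw', map_sub, map_smul]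
  have hwc : (w : E) = x - φ x • v := rfl
  set z := l • (w : E) - A w with hzdef
  have hwz : (w : E) = H z := by
    have := hH.decomposition w
    rwa [hφw, zero_smul, zero_add] at this
  have hφz : φ z = 0 := hH.functional_range w
  have hBz : B w = b (J z) := by
    obtain ⟨h, -, hB⟩ := hH.perturbation_apply hv₀ hb 0 z
    simp only [zero_smul, zero_add] at hB
    rw [← hB]
    congr 1
    exact Subtype.ext hwz
  have hz1 : z = b (J z) - μ • H z + a • v := by
    rw [← hBz, ← hwz, hzdef, hAw, hBw, hwc]
    linear_combination (norm := module) hxa + φ x • heig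
  -- The unknown coefficient a is eliminated by applying φ.
  have ha : a = - φ (b (J z)) := by
    have := congrArg φ hz1
    rw [hφz, map_add, map_sub, map_smul, map_smul, hφ, hH.functional_comp, smul_zero, sub_zero,
      smul_eq_mul, mul_one] at this
    linear_combination -this
  have e0 : ‖b‖ * eigenConst φ H J v₀ ((μ₀ - l) • v₀) =
      ‖b‖ * ‖J‖ + ‖φ‖ * (‖b‖ * ‖J‖) * (‖v₀‖ + ‖H‖) +
        ‖b‖ * ‖(μ₀ - l) • v₀‖ * (1 + ‖φ‖ * (‖v₀‖ + ‖H‖)) := by unfold eigenConst; ring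
  have e0' : 0 ≤ ‖b‖ * ‖(μ₀ - l) • v₀‖ * (1 + ‖φ‖ * (‖v₀‖ + ‖H‖)) := by positivity
  have e1 : ‖b (J z)‖ ≤ ‖b‖ * ‖J‖ * ‖z‖ := by
    rw [mul_assoc]
    exact (b.le_opNorm _).trans (by gcongr; exact J.le_opNorm z)
  have e2 : ‖μ • H z‖ ≤ 1 / 4 * ‖z‖ := by
    rw [norm_smul]
    calc ‖μ‖ * ‖H z‖ ≤ ‖μ‖ * ((‖v₀‖ + ‖H‖) * ‖z‖) := by
          gcongr
          exact (H.le_opNorm z).trans (by gcongr; linarith [norm_nonneg v₀])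
      _ ≤ 1 / 4 * ‖z‖ := by rw [← mul_assoc]; gcongr
  have e3 : ‖a • v‖ ≤ ‖φ‖ * (‖b‖ * ‖J‖) * (‖v₀‖ + ‖H‖) * ‖z‖ := by
    rw [norm_smul, ha, norm_neg]
    calc ‖φ (b (J z))‖ * ‖v‖ ≤ (‖φ‖ * (‖b‖ * ‖J‖ * ‖z‖)) * (‖v₀‖ + ‖H‖) := by
          gcongr
          exact (φ.le_opNorm _).trans (by gcongr)
      _ = _ := by ring
  have e4 : ‖z‖ ≤ ‖b‖ * ‖J‖ * ‖z‖ + 1 / 4 * ‖z‖ + ‖φ‖ * (‖b‖ * ‖J‖) * (‖v₀‖ + ‖H‖) * ‖z‖ := by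
    conv_lhs => rw [hz1]
    exact (norm_add_le _ _).trans (add_le_add ((norm_sub_le _ _).trans (add_le_add e1 e2)) e3)
  have e5 : (‖b‖ * ‖J‖ + ‖φ‖ * (‖b‖ * ‖J‖) * (‖v₀‖ + ‖H‖)) * ‖z‖ ≤ 1 / 4 * ‖z‖ := by
    gcongr
    linarith
  have e6 : ‖z‖ ≤ 0 := by linarith
  rw [norm_le_zero_iff.1 e6, map_zero] at hwz
  exact sub_eq_zero.1 hwz

/-- Any x mapped to a multiple of v by l + μ - A - B is itself a multiple of v; by induction no
kernel of a power is larger than the span of v. -/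
theorem IsReducedResolvent.isAlgSimple_perturb (hH : IsReducedResolvent A l v₀ φ H)
    (hv₀ : IsEigenvector A l v₀) (hb : ∀ x : A.domain, B x = b (μ₀ • (x : E) - A x))
    (hsmall : 4 * (‖b‖ * eigenConst φ H (reducedComp l μ₀ v₀ φ H) v₀ ((μ₀ - l) • v₀)) ≤ 1)
    {μ : ℂ} (hμ : ‖μ‖ * (‖v₀‖ + ‖H‖) ≤ 1 / 4) {v : E} (hφ : φ v = 1) (hv : v ∈ A.domain)
    (heig : A ⟨v, hv⟩ + B ⟨v, hv⟩ = (l + μ) • v) (hvn : ‖v‖ ≤ ‖v₀‖ + ‖H‖) :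
    IsAlgSimple (perturb A B) (l + μ) := by
  have hv0 : v ≠ 0 := by rintro rfl; simp at hφ
  have heig' : IsEigenvector (perturb A B) (l + μ) v := ⟨hv0, hv, heig⟩
  refine ⟨⟨v, heig'⟩, ?_⟩
  have hle : ∀ m, kerPow (perturb A B) (l + μ) m ≤ Submodule.span ℂ {v} := by
    intro m
    induction m with
    | zero => exact bot_le
    | succ m ih =>
      intro x hx
      obtain ⟨hxd, hxm⟩ := (mem_kerPow_succ _ _ _ _).1 hx
      obtain ⟨a, ha⟩ := Submodule.mem_span_singleton.1 (ih hxm)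
      rw [hH.eq_smul_of_sub_apply_eq hv₀ hb hsmall hμ hφ hv heig hvn hxd ha.symm]
      exact Submodule.smul_mem _ _ (Submodule.mem_span_singleton_self v)
  have hspan : genEigenspace (perturb A B) (l + μ) = Submodule.span ℂ {v} := by
    refine le_antisymm (iSup_le hle) ?_
    rw [Submodule.span_singleton_le_iff_mem]
    refine kerPow_le_genEigenspace _ _ 1 ((kerPow_one _ _ _).2 ⟨hv, ?_⟩)
    rw [perturb_apply, heig, sub_self]
  rw [hspan]
  exact finrank_span_singleton hv0

end Perturbation

end UnboundedOp

/-! ### Orbits of the semigroup and variation of constants -/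

namespace UnboundedOp

theorem evalAt_of_mem {E : Type*} [NormedAddCommGroup E] [NormedSpace ℂ E] {A : E →ₗ.[ℂ] E}
    (B : A.domain →ₗ[ℂ] E) {y : E} (h : y ∈ A.domain) : evalAt B y = B ⟨y, h⟩ := dif_pos h

end UnboundedOp

namespace C0Semigroup

variable {E : Type*} [NormedAddCommGroup E] [NormedSpace ℂ E] {S : C0Semigroup E}

theorem HasGen.exists_generator_eq {x y : E} (h : S.HasGen x y) :
    ∃ hx : x ∈ S.generator.domain, S.generator ⟨x, hx⟩ = y :=
  ⟨⟨y, h⟩, tendsto_nhds_unique (S.hasGen_generator ⟨x, ⟨y, h⟩⟩) h⟩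

theorem T_add_apply {s t : ℝ} (hs : 0 ≤ s) (ht : 0 ≤ t) (x : E) :
    S.T (s + t) x = S.T s (S.T t x) := by rw [S.map_add s t hs ht]; rfl

theorem T_zero_apply (x : E) : S.T 0 x = x := by rw [S.map_zero]; rfl

theorem HasGen.orbit {x y : E} (h : S.HasGen x y) {t : ℝ} (ht : 0 ≤ t) :
    S.HasGen (S.T t x) (S.T t y) := by
  refine (((S.T t).continuous.tendsto y).comp h).congr' ?_
  filter_upwards [self_mem_nhdsWithin] with s hs
  have hs' : 0 ≤ s := le_of_lt hs
  simp only [Function.comp_apply, map_smul, map_sub]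
  rw [← T_add_apply ht hs', ← T_add_apply hs' ht, add_comm]

theorem exists_generator_orbit (x : S.generator.domain) {t : ℝ} (ht : 0 ≤ t) :
    ∃ h : S.T t x ∈ S.generator.domain, S.generator ⟨S.T t x, h⟩ = S.T t (S.generator x) :=
  ((S.hasGen_generator x).orbit ht).exists_generator_eq

/-- The right difference quotient of the orbit at t is the generator's quotient at T(t)x. Hence T(t)
maps all of E into the domain for t > 0, and B T(t) is defined everywhere. -/
theorem exists_generator_eq_deriv (hdiff : S.ImmediatelyDifferentiable) (x : E) {t : ℝ}
    (ht : 0 < t) : ∃ h : S.T t x ∈ S.generator.domain,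
      S.generator ⟨S.T t x, h⟩ = deriv (fun s => S.T s x) t := by
  apply HasGen.exists_generator_eq
  have h := hasDerivAt_iff_tendsto_slope_zero.1 (hdiff x t ht).hasDerivAt
  refine (h.mono_left (nhdsWithin_mono _ fun s hs => ne_of_gt hs)).congr' ?_
  filter_upwards [self_mem_nhdsWithin] with s hs
  have hs' : 0 ≤ s := le_of_lt hs
  rw [Complex.coe_smul, ← T_add_apply hs' ht.le, add_comm]

theorem deriv_orbit (hdiff : S.ImmediatelyDifferentiable) (x : S.generator.domain) {t : ℝ}
    (ht : 0 < t) : deriv (fun s => S.T s x) t = S.T t (S.generator x) := by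
  obtain ⟨h, h1⟩ := exists_generator_eq_deriv hdiff (x : E) ht
  obtain ⟨h', h2⟩ := exists_generator_orbit x ht.le
  rw [← h1, ← h2]

theorem continuousOn_orbit (hdiff : S.ImmediatelyDifferentiable) (x : E) :
    ContinuousOn (fun t => S.T t x) (Ici 0) := by
  intro t ht
  rcases eq_or_lt_of_le (show (0 : ℝ) ≤ t from ht) with rfl | h0
  · rw [← continuousWithinAt_Ioi_iff_Ici, ContinuousWithinAt, T_zero_apply]
    exact S.tendsto_zero x
  · exact (hdiff x t h0).continuousAt.continuousWithinAt

/-- Near t, the derivative at s is T(s - t/2) A T(t/2)x, the orbit of a fixed vector. -/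
theorem continuousOn_deriv_orbit (hdiff : S.ImmediatelyDifferentiable) (x : E) :
    ContinuousOn (fun t => deriv (fun s => S.T s x) t) (Ioi 0) := by
  intro t ht
  have ht' : 0 < t := ht
  obtain ⟨h, hg⟩ := exists_generator_eq_deriv hdiff x (half_pos ht')
  set y := deriv (fun s => S.T s x) (t / 2)
  have hev : (fun s => deriv (fun r => S.T r x) s) =ᶠ[𝓝 t] fun s => S.T (s - t / 2) y := by
    filter_upwards [Ioi_mem_nhds (show t / 2 < t by linarith)] with s hs
    have hs' : 0 ≤ s - t / 2 := sub_nonneg.2 (le_of_lt hs)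
    obtain ⟨h1, h2⟩ := exists_generator_orbit ⟨_, h⟩ hs'
    obtain ⟨h3, h4⟩ := exists_generator_eq_deriv hdiff x
      (show 0 < s from lt_trans (half_pos ht') hs)
    rw [← h4, ← hg, ← h2]
    congr 1
    refine Subtype.ext ?_
    change S.T s x = S.T (s - t / 2) (S.T (t / 2) x)
    rw [← T_add_apply hs' (half_pos ht').le, sub_add_cancel]
  refine ContinuousAt.continuousWithinAt (ContinuousAt.congr ?_ hev.symm)
  have h5 : ContinuousAt (fun s => S.T s y) (t - t / 2) :=
    (hdiff y _ (by linarith)).continuousAt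
  exact ContinuousAt.comp (f := fun s => s - t / 2) h5 (by fun_prop)

section Perturbation

variable {B : S.generator.domain →ₗ[ℂ] E} {b : E →L[ℂ] E} {μ₀ : ℂ}

theorem evalAt_orbit (hdiff : S.ImmediatelyDifferentiable)
    (hb : ∀ x : S.generator.domain, B x = b (μ₀ • (x : E) - S.generator x)) (x : E) {t : ℝ}
    (ht : 0 < t) :
    UnboundedOp.evalAt B (S.T t x) = b (μ₀ • S.T t x - deriv (fun s => S.T s x) t) := by
  obtain ⟨h, hg⟩ := exists_generator_eq_deriv hdiff x ht
  rw [UnboundedOp.evalAt_of_mem B h, hb, hg]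

theorem continuousOn_evalAt_orbit (hdiff : S.ImmediatelyDifferentiable)
    (hb : ∀ x : S.generator.domain, B x = b (μ₀ • (x : E) - S.generator x)) (x : E) :
    ContinuousOn (fun t => UnboundedOp.evalAt B (S.T t x)) (Ioi 0) := by
  refine ContinuousOn.congr (f := fun t => b (μ₀ • S.T t x - deriv (fun s => S.T s x) t)) ?_
    fun t ht => evalAt_orbit hdiff hb x ht
  refine b.continuous.comp_continuousOn (ContinuousOn.sub ?_ (continuousOn_deriv_orbit hdiff x))
  exact ((continuousOn_orbit hdiff x).mono Ioi_subset_Ici_self).const_smul μ₀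

open MeasureTheory in
/-- The Miyadera condition extends from the domain of the generator to the whole space. -/
theorem Admissible.extend (hdiff : S.ImmediatelyDifferentiable)
    (hb : ∀ x : S.generator.domain, B x = b (μ₀ • (x : E) - S.generator x))
    (hadm : S.Admissible B) :
    ∃ q t₀ : ℝ, 0 < q ∧ q < 1 ∧ 0 < t₀ ∧ ∀ x : E,
      IntervalIntegrable (fun s => UnboundedOp.evalAt B (S.T s x)) volume 0 t₀ ∧
      ∫ s in (0 : ℝ)..t₀, ‖UnboundedOp.evalAt B (S.T s x)‖ ≤ q * ‖x‖ := by
  obtain ⟨q, t₀, hq0, hq1, ht₀, hbd⟩ := hadm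
  refine ⟨q, t₀, hq0, hq1, ht₀, fun x => ?_⟩
  set f : ℝ → E := fun s => UnboundedOp.evalAt B (S.T s x) with hf
  have hfc : ContinuousOn f (Ioi 0) := continuousOn_evalAt_orbit hdiff hb x
  have hfi : ∀ a c : ℝ, 0 < a → a ≤ c → IntervalIntegrable f volume a c := fun a c ha hac =>
    (hfc.mono fun s hs => lt_of_lt_of_le ha hs.1).intervalIntegrable_of_Icc hac
  -- T(a)x lies in the domain, so the hypothesis applies to it; the semigroup law shifts the
  -- interval of integration by a, and a → 0 at the end.
  have hshift : ∀ a, 0 < a → a ≤ t₀ → ∫ s in a..t₀, ‖f s‖ ≤ q * ‖S.T a x‖ := by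
    intro a ha hat
    obtain ⟨hd, -⟩ := exists_generator_eq_deriv hdiff x ha
    have h1 := hbd _ hd
    have h2 : ∫ s in (0 : ℝ)..t₀, ‖UnboundedOp.evalAt B (S.T s (S.T a x))‖ =
        ∫ s in (0 : ℝ)..t₀, ‖f (s + a)‖ := by
      refine intervalIntegral.integral_congr fun s hs => ?_
      rw [uIcc_of_le ht₀.le] at hs
      simp only [hf, T_add_apply hs.1 ha.le]
    rw [h2, intervalIntegral.integral_comp_add_right (fun s => ‖f s‖), zero_add] at h1
    refine le_trans ?_ h1
    rw [← intervalIntegral.integral_add_adjacent_intervals (hfi a t₀ ha hat).norm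
      (hfi t₀ (t₀ + a) ht₀ (by linarith)).norm]
    have : 0 ≤ ∫ s in t₀..(t₀ + a), ‖f s‖ :=
      intervalIntegral.integral_nonneg (by linarith) fun _ _ => norm_nonneg _
    linarith
  let a : ℕ → ℝ := fun n => t₀ * (1 / ((n : ℝ) + 1))
  have ha0 : ∀ n, 0 < a n := fun n => by positivity
  have hat : ∀ n, a n ≤ t₀ := fun n => by
    refine mul_le_of_le_one_right ht₀.le ?_
    rw [div_le_one (by positivity)]
    linarith [(Nat.cast_nonneg n : (0 : ℝ) ≤ n)]
  have halim : Tendsto a atTop (𝓝 0) := by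
    simpa [a] using (tendsto_one_div_add_atTop_nhds_zero_nat (𝕜 := ℝ)).const_mul t₀
  have halim' : Tendsto a atTop (𝓝[>] 0) :=
    tendsto_nhdsWithin_iff.2 ⟨halim, Eventually.of_forall ha0⟩
  have hT : Tendsto (fun n => q * ‖S.T (a n) x‖) atTop (𝓝 (q * ‖x‖)) :=
    (((S.tendsto_zero x).comp halim').norm).const_mul q
  -- The + 1 only leaves room, as q‖T(a)x‖ merely tends to q‖x‖; the sharp constant is recovered in
  -- the limit afterwards.
  have hint : IntegrableOn f (Ioc 0 t₀) := by
    refine integrableOn_Ioc_of_intervalIntegral_norm_bounded_left (I := q * ‖x‖ + 1)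
      (l := atTop) (fun n => ?_) halim ?_
    · exact (intervalIntegrable_iff_integrableOn_Ioc_of_le (hat n)).1 (hfi _ _ (ha0 n) (hat n))
    · filter_upwards [hT.eventually_le_const (lt_add_one (q * ‖x‖))] with n hn
      rw [← intervalIntegral.integral_of_le (hat n)]
      exact (hshift _ (ha0 n) (hat n)).trans hn
  refine ⟨(intervalIntegrable_iff_integrableOn_Ioc_of_le ht₀.le).2 hint, ?_⟩
  have hlim : Tendsto (fun n => ∫ s in (a n)..t₀, ‖f s‖) atTop (𝓝 (∫ s in (0 : ℝ)..t₀, ‖f s‖)) := by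
    have hc := intervalIntegral.continuousOn_primitive_interval_left (a := 0) (b := t₀)
      (f := fun s => ‖f s‖) (μ := volume) (by
        rw [uIcc_of_le ht₀.le, integrableOn_Icc_iff_integrableOn_Ioc]; exact hint.norm)
    rw [uIcc_of_le ht₀.le] at hc
    refine (hc 0 ⟨le_rfl, ht₀.le⟩).tendsto.comp (tendsto_nhdsWithin_iff.2 ⟨halim, ?_⟩)
    exact Eventually.of_forall fun n => ⟨(ha0 n).le, hat n⟩
  exact le_of_tendsto_of_tendsto' hlim hT fun n => hshift _ (ha0 n) (hat n)

open MeasureTheory in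
/-- Variation of constants for an eigenvector `v` of `A + B`. -/
theorem eigenvector_eq_add_integral [CompleteSpace E] (hdiff : S.ImmediatelyDifferentiable)
    {l : ℂ} {v w : E} (hv : v ∈ S.generator.domain) (hw : S.generator ⟨v, hv⟩ + w = l • v)
    {t : ℝ} (ht : 0 < t) :
    v = Complex.exp (-l * t) • S.T t v + ∫ s in (0 : ℝ)..t, Complex.exp (-l * s) • S.T s w := by
  have hexp : ∀ s : ℝ, HasDerivAt (fun s : ℝ => Complex.exp (-l * s))
      (Complex.exp (-l * s) * -l) s := fun s => by
    simpa using ((Complex.ofRealCLM.hasDerivAt (x := s)).const_mul (-l)).cexp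
  have hexpc : Continuous fun s : ℝ => Complex.exp (-l * s) := by fun_prop
  have hAv : S.generator ⟨v, hv⟩ = l • v - w := eq_sub_of_add_eq hw
  have key := intervalIntegral.integral_eq_sub_of_hasDerivAt_of_le ht.le
    (f := fun s : ℝ => Complex.exp (-l * s) • S.T s v)
    (f' := fun s => -(Complex.exp (-l * s) • S.T s w))
    (hexpc.continuousOn.smul ((continuousOn_orbit hdiff v).mono Icc_subset_Ici_self))
    (fun s hs => by
      have h1 := (hdiff v s hs.1).hasDerivAt
      rw [deriv_orbit hdiff ⟨v, hv⟩ hs.1, hAv] at h1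
      refine ((hexp s).smul h1).congr_deriv ?_
      simp only [map_sub, map_smul]
      module)
    (ContinuousOn.intervalIntegrable_of_Icc ht.le (hexpc.continuousOn.smul
      ((continuousOn_orbit hdiff w).mono Icc_subset_Ici_self)).neg)
  rw [intervalIntegral.integral_neg] at key
  simp only [Complex.ofReal_zero, mul_zero, Complex.exp_zero, one_smul, T_zero_apply] at key
  linear_combination (norm := module) key

open MeasureTheory in
/-- The variation of constants formula after application of `B`. -/
theorem perturbation_eigenvector_eq_add_integral [CompleteSpace E]
    (hdiff : S.ImmediatelyDifferentiable)
    (hb : ∀ x : S.generator.domain, B x = b (μ₀ • (x : E) - S.generator x))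
    {l : ℂ} {v : E} (hv : v ∈ S.generator.domain)
    (heig : S.generator ⟨v, hv⟩ + B ⟨v, hv⟩ = l • v) {t : ℝ} (ht : 0 < t)
    (hint : IntervalIntegrable (fun s => UnboundedOp.evalAt B (S.T s (B ⟨v, hv⟩))) volume 0 t) :
    B ⟨v, hv⟩ = Complex.exp (-l * t) • UnboundedOp.evalAt B (S.T t v) +
      ∫ s in (0 : ℝ)..t, Complex.exp (-l * s) • UnboundedOp.evalAt B (S.T s (B ⟨v, hv⟩)) := by
  have hexp : ∀ s : ℝ, HasDerivAt (fun s : ℝ => Complex.exp (-l * s))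
      (Complex.exp (-l * s) * -l) s := fun s => by
    simpa using ((Complex.ofRealCLM.hasDerivAt (x := s)).const_mul (-l)).cexp
  have hexpc : Continuous fun s : ℝ => Complex.exp (-l * s) := by fun_prop
  set w := B ⟨v, hv⟩ with hw
  set a := S.generator ⟨v, hv⟩ with ha
  have hwl : w = l • v - a := eq_sub_of_add_eq' heig
  set y := μ₀ • v - a with hy
  have hwy : w = b y := hb ⟨v, hv⟩
  -- With y = (μ₀ - A)v one has B T(s)v = b T(s)y, which is continuous up to s = 0. Differentiating
  -- this function avoids moving the unbounded B through an integral.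
  have key := intervalIntegral.integral_eq_sub_of_hasDerivAt_of_le ht.le
    (f := fun s : ℝ => Complex.exp (-l * s) • b (S.T s y))
    (f' := fun s => -(Complex.exp (-l * s) • UnboundedOp.evalAt B (S.T s w)))
    (hexpc.continuousOn.smul (b.continuous.comp_continuousOn
      ((continuousOn_orbit hdiff y).mono Icc_subset_Ici_self)))
    (fun s hs => by
      have h1 := (hdiff v s hs.1).hasDerivAt
      rw [deriv_orbit hdiff ⟨v, hv⟩ hs.1, ← ha] at h1
      have h2 := (hdiff a s hs.1).hasDerivAt
      have h3 : HasDerivAt (fun r => S.T r w) (l • S.T s a - deriv (fun r => S.T r a) s) s := by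
        refine ((h1.const_smul l).sub h2).congr_of_eventuallyEq (Eventually.of_forall fun r => ?_)
        simp [hwl]
      have h4 : HasDerivAt (fun r => S.T r y) (μ₀ • S.T s a - deriv (fun r => S.T r a) s) s := by
        refine ((h1.const_smul μ₀).sub h2).congr_of_eventuallyEq (Eventually.of_forall fun r => ?_)
        simp [hy]
      have h5 : HasDerivAt (fun r => b (S.T r y))
          (b (μ₀ • S.T s a - deriv (fun r => S.T r a) s)) s :=
        (b.restrictScalars ℝ).hasFDerivAt.comp_hasDerivAt s h4
      rw [evalAt_orbit hdiff hb w hs.1, h3.deriv]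
      refine ((hexp s).smul h5).congr_deriv ?_
      rw [hwl, hy]
      simp only [map_sub, map_smul]
      module)
    (hint.continuousOn_smul hexpc.continuousOn).neg
  obtain ⟨hd, hg⟩ := exists_generator_orbit ⟨v, hv⟩ ht.le
  have h6 : UnboundedOp.evalAt B (S.T t v) = b (S.T t y) := by
    rw [UnboundedOp.evalAt_of_mem B hd, hb, hg, ← ha, hy, map_sub (S.T t), map_smul (S.T t)]
  rw [intervalIntegral.integral_neg] at key
  simp only [Complex.ofReal_zero, mul_zero, Complex.exp_zero, one_smul, T_zero_apply] at key
  rw [h6]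
  linear_combination (norm := module) hwy + key

end Perturbation

end C0Semigroup

/-! ### Integration in the complexified lattice and the gauge norm -/

namespace LatticeCplx

variable {F : Type*} [NormedAddCommGroup F] [Lattice F] [HasSolidNorm F] [IsOrderedAddMonoid F]
  [NormedSpace ℝ F] [IsOrderedModule ℝ F] [CompleteSpace F]

theorem real_smul_re (a : ℝ) (z : LatticeCplx F) : (a • z).re = a • z.re := by
  rw [← Complex.coe_smul, smul_re]; simp

theorem real_smul_im (a : ℝ) (z : LatticeCplx F) : (a • z).im = a • z.im := by
  rw [← Complex.coe_smul, smul_im]; simp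

theorem norm_rot_le (z : LatticeCplx F) (θ : ℝ) : ‖rot z.re z.im θ‖ ≤ ‖z‖ := by
  rw [norm_eq, ← norm_abs_eq_norm]
  refine norm_le_of_le (abs_nonneg _) (abs_le'.2 ⟨rot_le_modulus z θ, ?_⟩)
  have h : -rot z.re z.im θ = rot z.re z.im (θ + Real.pi) := by
    simp only [rot, Real.cos_add_pi, Real.sin_add_pi]; module
  rw [h]
  exact rot_le_modulus z _

/-- `z ↦ Re (e^{-iθ} z)` as a bounded real-linear map. -/
noncomputable def rotCLM (θ : ℝ) : LatticeCplx F →L[ℝ] F :=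
  LinearMap.mkContinuous
    { toFun := fun z => rot z.re z.im θ
      map_add' := fun z w => by simp only [rot, add_re, add_im]; module
      map_smul' := fun a z => by
        simp only [rot, real_smul_re, real_smul_im, RingHom.id_apply]; module }
    1 fun z => by simpa using norm_rot_le z θ

theorem rotCLM_apply (θ : ℝ) (z : LatticeCplx F) : rotCLM θ z = rot z.re z.im θ := rfl

/-- A bound on the modulus is a family of order bounds on the continuous maps `rotCLM θ`, each of
which is a closed condition. -/
theorem isClosed_modulus_le (x : F) : IsClosed {z : LatticeCplx F | z.modulus ≤ x} := by
  have : {z : LatticeCplx F | z.modulus ≤ x} = ⋂ θ, (rotCLM θ) ⁻¹' Iic x := by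
    ext z
    simp only [mem_ofPred_eq, mem_iInter, mem_preimage, mem_Iic, rotCLM_apply]
    exact ⟨fun h θ => (rot_le_modulus z θ).trans h, modulus_le⟩
  rw [this]
  exact isClosed_iInter fun θ => isClosed_Iic.preimage (rotCLM θ).continuous

open MeasureTheory in
-- Each `rotCLM θ` commutes with the integral, so it suffices to integrate an order inequality in F
-- for every fixed θ.
theorem modulus_intervalIntegral_le {f : ℝ → LatticeCplx F} {g : ℝ → ℝ} {u : F} {t : ℝ}
    (ht : 0 ≤ t) (hf : IntervalIntegrable f volume 0 t) (hg : IntervalIntegrable g volume 0 t)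
    (hfg : ∀ s ∈ Ioc 0 t, (f s).modulus ≤ g s • u) :
    (∫ s in (0 : ℝ)..t, f s).modulus ≤ (∫ s in (0 : ℝ)..t, g s) • u := by
  refine modulus_le fun θ => ?_
  rw [← rotCLM_apply, ← (rotCLM θ).intervalIntegral_comp_comm hf,
    ← intervalIntegral.integral_smul_const, intervalIntegral.integral_of_le ht,
    intervalIntegral.integral_of_le ht]
  have hf' := (intervalIntegrable_iff_integrableOn_Ioc_of_le ht).1 hf
  have hg' := (intervalIntegrable_iff_integrableOn_Ioc_of_le ht).1 hg
  refine setIntegral_mono_on ?_ ?_ measurableSet_Ioc fun s hs => ?_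
  · exact (rotCLM θ).integrable_comp hf'
  · exact hg'.smul_const u
  · exact (rot_le_modulus _ θ).trans (hfg s hs)

section Gauge

variable {u : F}

theorem gaugeNorm_nonneg (u : F) (z : LatticeCplx F) : 0 ≤ gaugeNorm u z :=
  Real.sInf_nonneg fun _ h => h.1.le

theorem gaugeNorm_le_of_pos {z : LatticeCplx F} {c : ℝ} (hc : 0 < c) (h : z.modulus ≤ c • u) :
    gaugeNorm u z ≤ c := csInf_le ⟨0, fun _ h => h.1.le⟩ ⟨hc, h⟩

theorem gaugeNorm_le (hu : 0 ≤ u) {z : LatticeCplx F} {c : ℝ} (hc : 0 ≤ c)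
    (h : z.modulus ≤ c • u) : gaugeNorm u z ≤ c :=
  le_of_forall_pos_le_add fun ε hε => gaugeNorm_le_of_pos (by positivity)
    (h.trans (smul_le_smul_of_nonneg_right (by linarith) hu))

theorem mem_principalIdeal_of_le (hu : 0 ≤ u) {z : LatticeCplx F} {c : ℝ} (h : z.modulus ≤ c • u) :
    z ∈ principalIdeal u :=
  ⟨max c 1, by positivity, h.trans (smul_le_smul_of_nonneg_right (le_max_left _ _) hu)⟩

/-- The infimum is attained because order intervals are closed in the norm topology. -/
theorem modulus_le_gaugeNorm_smul {z : LatticeCplx F} (hu : 0 ≤ u) (hz : z ∈ principalIdeal u) :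
    z.modulus ≤ gaugeNorm u z • u := by
  have h1 : ∀ ε : ℝ, 0 < ε → z.modulus ≤ (gaugeNorm u z + ε) • u := by
    intro ε hε
    obtain ⟨c, hc, hlt⟩ := exists_lt_of_csInf_lt (s := {c : ℝ | 0 < c ∧ z.modulus ≤ c • u}) hz
      (show gaugeNorm u z < gaugeNorm u z + ε by linarith)
    exact hc.2.trans (smul_le_smul_of_nonneg_right hlt.le hu)
  have h2 : Tendsto (fun ε : ℝ => (gaugeNorm u z + ε) • u) (𝓝[>] 0) (𝓝 (gaugeNorm u z • u)) := by
    have : Continuous fun ε : ℝ => (gaugeNorm u z + ε) • u := by fun_prop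
    simpa using (this.tendsto 0).mono_left nhdsWithin_le_nhds
  refine ge_of_tendsto h2 ?_
  filter_upwards [self_mem_nhdsWithin] with ε hε using h1 ε hε

theorem modulus_smul_le_of_le {z : LatticeCplx F} {c : ℝ} (a : ℂ) (h : z.modulus ≤ c • u) :
    (a • z).modulus ≤ (‖a‖ * c) • u := by
  rw [mul_smul]
  exact (modulus_smul_le a z).trans (smul_le_smul_of_nonneg_left h (norm_nonneg a))

theorem modulus_add_le_of_le {z w : LatticeCplx F} {c d : ℝ} (h : z.modulus ≤ c • u)
    (h' : w.modulus ≤ d • u) : (z + w).modulus ≤ (c + d) • u := by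
  rw [add_smul]
  exact (modulus_add_le z w).trans (add_le_add h h')

theorem modulus_zero : (0 : LatticeCplx F).modulus = 0 := by
  rw [← norm_eq_zero, ← norm_eq, norm_zero]

variable (u) in
/-- The principal ideal `E_u` as a subspace. -/
def idealSubmodule (hu : 0 ≤ u) : Submodule ℂ (LatticeCplx F) where
  carrier := principalIdeal u
  add_mem' := fun ⟨_, _, h⟩ ⟨_, _, h'⟩ => mem_principalIdeal_of_le hu (modulus_add_le_of_le h h')
  zero_mem' := mem_principalIdeal_of_le (c := 0) hu (by rw [modulus_zero, zero_smul])
  smul_mem' := fun a _ ⟨_, _, h⟩ => mem_principalIdeal_of_le hu (modulus_smul_le_of_le a h)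

variable (u) in
/-- The principal ideal `E_u`, to be equipped with the gauge norm. -/
def IdealSpace (hu : 0 ≤ u) : Type _ := ↥(idealSubmodule u hu)

instance (hu : 0 ≤ u) : AddCommGroup (IdealSpace u hu) :=
  inferInstanceAs (AddCommGroup ↥(idealSubmodule u hu))

instance (hu : 0 ≤ u) : Module ℂ (IdealSpace u hu) :=
  inferInstanceAs (Module ℂ ↥(idealSubmodule u hu))

noncomputable instance (hu : 0 ≤ u) : Norm (IdealSpace u hu) := ⟨fun z => gaugeNorm u z.1⟩

/-- This makes E_u a legitimate target for the Hartogs-type lemma, which does not require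
completeness. -/
theorem idealSpace_normedSpaceCore (hu : 0 ≤ u) : NormedSpace.Core ℂ (IdealSpace u hu) := by
  have hsm : ∀ (a : ℂ) (z : IdealSpace u hu), ‖a • z‖ ≤ ‖a‖ * ‖z‖ := fun a z =>
    gaugeNorm_le hu (mul_nonneg (norm_nonneg a) (gaugeNorm_nonneg u z.1))
      (modulus_smul_le_of_le a (modulus_le_gaugeNorm_smul hu z.2))
  refine ⟨⟨fun z => gaugeNorm_nonneg u z.1, fun a z => le_antisymm (hsm a z) ?_, fun z w => ?_⟩,
    fun z => ?_⟩
  · rcases eq_or_ne a 0 with rfl | ha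
    · rw [norm_zero, zero_mul]
      exact gaugeNorm_nonneg u _
    · have h := hsm a⁻¹ (a • z)
      rw [smul_smul, inv_mul_cancel₀ ha, one_smul, norm_inv] at h
      have ha' : 0 < ‖a‖ := norm_pos_iff.2 ha
      rwa [inv_mul_eq_div, le_div_iff₀ ha', mul_comm] at h
  · exact gaugeNorm_le hu (add_nonneg (gaugeNorm_nonneg u z.1) (gaugeNorm_nonneg u w.1))
      (modulus_add_le_of_le (modulus_le_gaugeNorm_smul hu z.2) (modulus_le_gaugeNorm_smul hu w.2))
  · constructor
    · intro h
      have h1 := modulus_le_gaugeNorm_smul hu z.2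
      rw [show gaugeNorm u z.1 = 0 from h, zero_smul] at h1
      have h2 : z.1.modulus = 0 := le_antisymm h1 (modulus_nonneg _)
      refine Subtype.ext (norm_eq_zero.1 ?_)
      rw [norm_eq, h2, norm_zero]
    · rintro rfl
      refine le_antisymm (gaugeNorm_le hu le_rfl ?_) (gaugeNorm_nonneg u _)
      rw [zero_smul]
      exact modulus_zero.le

noncomputable instance (hu : 0 ≤ u) : NormedAddCommGroup (IdealSpace u hu) :=
  NormedAddCommGroup.ofCore (idealSpace_normedSpaceCore hu)

noncomputable instance (hu : 0 ≤ u) : NormedSpace ℂ (IdealSpace u hu) where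
  norm_smul_le a z := ((idealSpace_normedSpaceCore hu).norm_smul a z).le

/-- A Hartogs-type bound for an ultracontractive semigroup along a holomorphic family. -/
theorem exists_gaugeNorm_le_rpow (hu : 0 ≤ u) {S : C0Semigroup (LatticeCplx F)}
    (hS : Ultracontractive S u)
    {C : ℝ} (hC : ∀ t ∈ Ioc (0 : ℝ) 1, ∀ x ∈ principalIdeal u,
      gaugeNorm u (S.T t x) ≤ C * gaugeNorm u x)
    {f : ℂ → LatticeCplx F} {ρ : ℝ} (hρ : 0 < ρ) (hf : DifferentiableOn ℂ f (Metric.ball 0 ρ))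
    (hmem : ∀ κ ∈ Metric.ball (0 : ℂ) ρ, f κ ∈ principalIdeal u) :
    ∃ ρ' > 0, ∃ K : ℝ, ∀ κ ∈ Metric.ball (0 : ℂ) ρ', ∀ t ∈ Ioc (0 : ℝ) 1,
      gaugeNorm u (S.T t (f κ)) ≤ K * t ^ (-(1 / 2) : ℝ) := by
  classical
  obtain ⟨C', α, hC', hα, hS⟩ := hS
  -- T(t) as a bounded operator from E to E_u; the value 0 outside (0, 1] is never used.
  let L : ℝ → LatticeCplx F →L[ℂ] IdealSpace u hu := fun t =>
    if h : t ∈ Ioc (0 : ℝ) 1 then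
      LinearMap.mkContinuous
        { toFun := fun x => (⟨S.T t x, (hS t h x).1⟩ : ↥(idealSubmodule u hu))
          map_add' := fun x y => Subtype.ext (map_add (S.T t) x y)
          map_smul' := fun a x => Subtype.ext (map_smul (S.T t) a x) }
        (C' * t ^ (-α)) fun x => (hS t h x).2
    else 0
  have hL : ∀ t ∈ Ioc (0 : ℝ) 1, ∀ x, ‖L t x‖ = gaugeNorm u (S.T t x) := by
    intro t ht x
    simp only [L, dif_pos ht]
    rfl
  obtain ⟨ρ', hρ', K, h⟩ := exists_norm_le_rpow_of_pointwise_bounded L hα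
    (fun t ht x => by rw [hL t ht]; exact (hS t ht x).2) hρ hf
    (fun κ hκ => ⟨C * gaugeNorm u (f κ), fun t ht => by
      rw [hL t ht]; exact hC t ht _ (hmem κ hκ)⟩)
  exact ⟨ρ', hρ', K, fun κ hκ t ht => by rw [← hL t ht]; exact h κ hκ t ht⟩

end Gauge

/-! ### Regularity: the perturbation maps eigenvectors into the principal ideal -/

section Regularity

variable {u : F} {S : C0Semigroup (LatticeCplx F)} {B : S.generator.domain →ₗ[ℂ] LatticeCplx F}
  {b : LatticeCplx F →L[ℂ] LatticeCplx F} {μ₀ : ℂ}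

open MeasureTheory in
/-- For an eigenvector `v` of the perturbed generator, `B v` lies in the principal ideal. -/
theorem perturbation_eigenvector_mem_principalIdeal (hu : 0 ≤ u)
    (hdiff : S.ImmediatelyDifferentiable) (hultra : Ultracontractive S u)
    (hadm : S.Admissible B) (hideal : IdealBounds S B u)
    (hb : ∀ x : S.generator.domain, B x = b (μ₀ • (x : LatticeCplx F) - S.generator x))
    {l : ℂ} {v : LatticeCplx F} (hv : v ∈ S.generator.domain)
    (heig : S.generator ⟨v, hv⟩ + B ⟨v, hv⟩ = l • v) : B ⟨v, hv⟩ ∈ principalIdeal u := by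
  obtain ⟨q, t₀, hq0, hq1, ht₀, hq⟩ := hadm.extend hdiff hb
  obtain ⟨C, β, hC, hβ0, hβ1, hid⟩ := hideal
  obtain ⟨_, _, -, -, hul⟩ := hultra
  -- a time for which the Volterra operator is a contraction
  obtain ⟨t, ht, ht1, htt₀, hqt, hθ⟩ : ∃ t : ℝ, 0 < t ∧ t ≤ 1 ∧ t ≤ t₀ ∧
      Real.exp (‖l‖ * t) * q < 1 ∧ Real.exp (‖l‖ * t) * C * (t ^ (1 - β) / (1 - β)) ≤ 1 / 2 := by
    have e1 : ∀ᶠ t : ℝ in 𝓝[>] 0, Real.exp (‖l‖ * t) * q < 1 := by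
      have : Tendsto (fun t : ℝ => Real.exp (‖l‖ * t) * q) (𝓝 0) (𝓝 q) := by
        have h : Continuous fun t : ℝ => Real.exp (‖l‖ * t) * q := by fun_prop
        simpa using h.tendsto 0
      exact (this.mono_left nhdsWithin_le_nhds).eventually_lt_const hq1
    have e2 : ∀ᶠ t : ℝ in 𝓝[>] 0,
        Real.exp (‖l‖ * t) * C * (t ^ (1 - β) / (1 - β)) ≤ 1 / 2 := by
      have : Tendsto (fun t : ℝ => Real.exp (‖l‖ * t) * C * (t ^ (1 - β) / (1 - β))) (𝓝 0)
          (𝓝 0) := by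
        have h : Continuous fun t : ℝ => Real.exp (‖l‖ * t) * C * (t ^ (1 - β) / (1 - β)) := by
          have := Real.continuous_rpow_const (show 0 ≤ 1 - β by linarith)
          fun_prop
        simpa [Real.zero_rpow (show 1 - β ≠ 0 by linarith)] using h.tendsto 0
      exact (this.mono_left nhdsWithin_le_nhds).eventually_le_const (by norm_num)
    have e3 : ∀ᶠ t : ℝ in 𝓝[>] 0, t ∈ Ioc 0 (min 1 t₀) := Ioc_mem_nhdsGT (by positivity)
    obtain ⟨t, h1, h2, h3⟩ := (e1.and (e2.and e3)).exists
    exact ⟨t, h3.1, h3.2.trans (min_le_left _ _), h3.2.trans (min_le_right _ _), h1, h2⟩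
  let f : LatticeCplx F → ℝ → LatticeCplx F := fun x s => UnboundedOp.evalAt B (S.T s x)
  have hfi : ∀ x, IntervalIntegrable (f x) volume 0 t := fun x =>
    (hq x).1.mono_set (by rw [uIcc_of_le ht.le, uIcc_of_le ht₀.le]; exact Icc_subset_Icc_right htt₀)
  have hexpc : Continuous fun s : ℝ => Complex.exp (-l * s) := by fun_prop
  have hexpn : ∀ s ∈ Ioc 0 t, ‖Complex.exp (-l * s)‖ ≤ Real.exp (‖l‖ * t) := by
    intro s hs
    rw [Complex.norm_exp]
    gcongr
    refine (Complex.re_le_norm _).trans ?_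
    rw [norm_mul, norm_neg, Complex.norm_real, Real.norm_of_nonneg hs.1.le]
    gcongr
    exact hs.2
  have hei : ∀ x, IntervalIntegrable (fun s : ℝ => Complex.exp (-l * s) • f x s) volume 0 t :=
    fun x => (hfi x).continuousOn_smul hexpc.continuousOn
  let K : LatticeCplx F → LatticeCplx F := fun x =>
    ∫ s in (0 : ℝ)..t, Complex.exp (-l * s) • f x s
  -- Although `evalAt B` is not additive on E, T(s)x lies in the domain for every s > 0, which
  -- suffices under the integral.
  have hKsub : ∀ x y, K (x - y) = K x - K y := by
    intro x y
    simp only [K]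
    rw [← intervalIntegral.integral_sub (hei x) (hei y)]
    rw [intervalIntegral.integral_of_le ht.le, intervalIntegral.integral_of_le ht.le]
    refine setIntegral_congr_fun measurableSet_Ioc fun s hs => ?_
    obtain ⟨hx, -⟩ := C0Semigroup.exists_generator_eq_deriv hdiff x hs.1
    obtain ⟨hy, -⟩ := C0Semigroup.exists_generator_eq_deriv hdiff y hs.1
    obtain ⟨hxy, -⟩ := C0Semigroup.exists_generator_eq_deriv hdiff (x - y) hs.1
    have h1 : f (x - y) s = f x s - f y s := by
      simp only [f]
      rw [UnboundedOp.evalAt_of_mem B hx, UnboundedOp.evalAt_of_mem B hy,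
        UnboundedOp.evalAt_of_mem B hxy, ← map_sub]
      congr 1
      exact Subtype.ext (map_sub (S.T s) x y)
    change Complex.exp (-l * s) • f (x - y) s = _
    rw [h1, smul_sub]
  have hKn : ∀ x, ‖K x‖ ≤ Real.exp (‖l‖ * t) * q * ‖x‖ := by
    intro x
    calc ‖K x‖ ≤ ∫ s in (0 : ℝ)..t, ‖Complex.exp (-l * s) • f x s‖ :=
          intervalIntegral.norm_integral_le_integral_norm ht.le
      _ ≤ ∫ s in (0 : ℝ)..t, Real.exp (‖l‖ * t) * ‖f x s‖ := by
          rw [intervalIntegral.integral_of_le ht.le, intervalIntegral.integral_of_le ht.le]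
          refine setIntegral_mono_on ?_ ?_ measurableSet_Ioc fun s hs => ?_
          · exact ((intervalIntegrable_iff_integrableOn_Ioc_of_le ht.le).1 (hei x)).norm
          · exact ((intervalIntegrable_iff_integrableOn_Ioc_of_le ht.le).1
              (hfi x).norm).const_mul _
          · rw [norm_smul]
            gcongr
            exact hexpn s hs
      _ = Real.exp (‖l‖ * t) * ∫ s in (0 : ℝ)..t, ‖f x s‖ :=
          intervalIntegral.integral_const_mul _ _
      _ ≤ Real.exp (‖l‖ * t) * (q * ‖x‖) := by
          gcongr
          refine le_trans ?_ (hq x).2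
          refine intervalIntegral.integral_mono_interval le_rfl ht.le htt₀
            (ae_of_all _ fun _ => norm_nonneg _) (hq x).1.norm
      _ = _ := by ring
  -- The weak singularity s^{-β} integrates to t^{1-β}/(1 - β), and t was chosen to make the
  -- resulting factor at most 1/2.
  have hKu : ∀ (x : LatticeCplx F) (m : ℝ), 0 ≤ m → x.modulus ≤ m • u →
      (K x).modulus ≤ (1 / 2 * m) • u := by
    intro x m hm hx
    have hxm := mem_principalIdeal_of_le hu hx
    have hxg := gaugeNorm_le hu hm hx
    have h1 := modulus_intervalIntegral_le (u := u)
      (g := fun s => Real.exp (‖l‖ * t) * (C * m) * s ^ (-β)) ht.le (hei x)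
      ((intervalIntegral.intervalIntegrable_rpow' (by linarith)).const_mul _) (fun s hs => by
        obtain ⟨hd, -⟩ := C0Semigroup.exists_generator_eq_deriv hdiff x hs.1
        have hs1 : s ∈ Ioc (0 : ℝ) 1 := ⟨hs.1, hs.2.trans ht1⟩
        obtain ⟨hm1, hm2⟩ := (hid s hs1 x hxm).2 hd
        have h3 := modulus_smul_le_of_le (Complex.exp (-l * s)) (modulus_le_gaugeNorm_smul hu hm1)
        simp only [f]
        rw [UnboundedOp.evalAt_of_mem B hd]
        refine h3.trans (smul_le_smul_of_nonneg_right ?_ hu)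
        have h4 : 0 ≤ s ^ (-β) := (Real.rpow_pos_of_pos hs.1 _).le
        calc _ ≤ Real.exp (‖l‖ * t) * (C * s ^ (-β) * m) := by
              refine mul_le_mul (hexpn s hs) (hm2.trans ?_) (gaugeNorm_nonneg _ _) (by positivity)
              gcongr
          _ = _ := by ring)
    refine h1.trans (smul_le_smul_of_nonneg_right ?_ hu)
    rw [intervalIntegral.integral_const_mul, integral_rpow (Or.inl (by linarith)),
      Real.zero_rpow (by linarith), sub_zero, show -β + 1 = 1 - β by ring]
    calc _ = Real.exp (‖l‖ * t) * C * (t ^ (1 - β) / (1 - β)) * m := by ring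
      _ ≤ _ := by gcongr
  set w := B ⟨v, hv⟩ with hw
  set a := Complex.exp (-l * t) • UnboundedOp.evalAt B (S.T t v) with ha
  have hwK : w = a + K w :=
    C0Semigroup.perturbation_eigenvector_eq_add_integral hdiff hb hv heig ht (hfi w)
  -- Split T(t) = T(t/2)T(t/2): the first half maps v into E_u, and B T(t/2) preserves E_u.
  obtain ⟨m, hm0, hm⟩ : ∃ m : ℝ, 0 < m ∧ a.modulus ≤ m • u := by
    have ht2 : 0 < t / 2 := half_pos ht
    have ht2' : t / 2 ∈ Ioc (0 : ℝ) 1 := ⟨ht2, by linarith⟩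
    obtain ⟨hd, -⟩ := C0Semigroup.exists_generator_eq_deriv hdiff (S.T (t / 2) v) ht2
    have h1 := ((hid _ ht2' _ (hul _ ht2' v).1).2 hd).1
    rw [← UnboundedOp.evalAt_of_mem B hd, ← C0Semigroup.T_add_apply ht2.le ht2.le,
      add_halves] at h1
    obtain ⟨c, hc, h⟩ := h1
    exact mem_principalIdeal_of_le hu (modulus_smul_le_of_le _ h)
  -- Picard iteration for w = a + Kw: it converges to w in E, while all iterates stay below 2m u
  -- since m + (2m)/2 = 2m. This order bound is closed in E and passes to w.
  let x : ℕ → LatticeCplx F := fun n => Nat.rec 0 (fun _ y => a + K y) n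
  have hxs : ∀ n, x (n + 1) = a + K (x n) := fun _ => rfl
  have hxm : ∀ n, (x n).modulus ≤ (2 * m) • u := by
    intro n
    induction n with
    | zero =>
      change (0 : LatticeCplx F).modulus ≤ _
      rw [modulus_zero]
      exact smul_nonneg (by positivity) hu
    | succ n ih =>
      rw [hxs]
      have := modulus_add_le_of_le hm (hKu _ _ (by positivity) ih)
      rwa [show m + 1 / 2 * (2 * m) = 2 * m by ring] at this
  have hxd : ∀ n, ‖x n - w‖ ≤ (Real.exp (‖l‖ * t) * q) ^ n * ‖w‖ := by
    intro n
    induction n with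
    | zero =>
      change ‖(0 : LatticeCplx F) - w‖ ≤ _
      simp
    | succ n ih =>
      have h1 : x (n + 1) - w = K (x n - w) := by
        rw [hKsub, hxs]
        linear_combination (norm := module) -hwK
      rw [h1, pow_succ']
      calc _ ≤ Real.exp (‖l‖ * t) * q * ‖x n - w‖ := hKn _
        _ ≤ Real.exp (‖l‖ * t) * q * ((Real.exp (‖l‖ * t) * q) ^ n * ‖w‖) := by gcongr
        _ = _ := by ring
  have hlim : Tendsto x atTop (𝓝 w) := by
    rw [tendsto_iff_norm_sub_tendsto_zero]
    refine squeeze_zero (fun _ => norm_nonneg _) hxd ?_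
    simpa using (tendsto_pow_atTop_nhds_zero_of_lt_one (by positivity) hqt).mul_const ‖w‖
  exact mem_principalIdeal_of_le hu
    ((isClosed_modulus_le ((2 * m) • u)).mem_of_tendsto hlim (Eventually.of_forall hxm))

end Regularity

end LatticeCplx

/-! ### Absence of further eigenvalues and boundedness relative to the resolvent -/

namespace UnboundedOp

variable {E : Type*} [NormedAddCommGroup E] [NormedSpace ℂ E] {A : E →ₗ.[ℂ] E}
  {B : A.domain →ₗ[ℂ] E} {l μ₀ : ℂ} {v₀ : E} {φ : E →L[ℂ] ℂ} {H : E →L[ℂ] E} {b : E →L[ℂ] E}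

/-- An eigenvector in the kernel of φ would be Hz with z = bJz - μHz, whose right side has norm at
most ‖z‖/2. Hence every eigenvector with eigenvalue near l can be normalised by φ = 1. -/
theorem IsReducedResolvent.functional_ne_zero (hH : IsReducedResolvent A l v₀ φ H)
    (hv₀ : IsEigenvector A l v₀) (hb : ∀ x : A.domain, B x = b (μ₀ • (x : E) - A x))
    (hsmall : 4 * (‖b‖ * eigenConst φ H (reducedComp l μ₀ v₀ φ H) v₀ ((μ₀ - l) • v₀)) ≤ 1)
    {μ : ℂ} (hμ : ‖μ‖ * (‖v₀‖ + ‖H‖) ≤ 1 / 4) {x : E} (hx : x ∈ A.domain)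
    (heig : A ⟨x, hx⟩ + B ⟨x, hx⟩ = (l + μ) • x) (hx0 : x ≠ 0) : φ x ≠ 0 := by
  intro hφ
  set J := reducedComp l μ₀ v₀ φ H
  set z := l • x - A ⟨x, hx⟩ with hzdef
  have hxz : x = H z := by
    have := hH.decomposition ⟨x, hx⟩
    rwa [hφ, zero_smul, zero_add] at this
  have hBz : B ⟨x, hx⟩ = b (J z) := by
    obtain ⟨h, -, hB⟩ := hH.perturbation_apply hv₀ hb 0 z
    simp only [zero_smul, zero_add] at hB
    rw [← hB]
    congr 1
    exact Subtype.ext hxz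
  have hz1 : z = b (J z) - μ • H z := by
    rw [← hBz, ← hxz, hzdef]
    linear_combination (norm := module) -heig
  have e0 : ‖b‖ * ‖J‖ ≤ 1 / 4 := by
    have h1 : ‖b‖ * eigenConst φ H J v₀ ((μ₀ - l) • v₀) = ‖b‖ * ‖J‖ +
      (‖b‖ * ‖J‖ * (‖φ‖ * (‖v₀‖ + ‖H‖)) +
        ‖b‖ * ‖(μ₀ - l) • v₀‖ * (1 + ‖φ‖ * (‖v₀‖ + ‖H‖))) := by unfold eigenConst; ring
    have h2 : 0 ≤ ‖b‖ * ‖J‖ * (‖φ‖ * (‖v₀‖ + ‖H‖)) +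
      ‖b‖ * ‖(μ₀ - l) • v₀‖ * (1 + ‖φ‖ * (‖v₀‖ + ‖H‖)) := by positivity
    linarith
  have e1 : ‖b (J z)‖ ≤ 1 / 4 * ‖z‖ := by
    calc ‖b (J z)‖ ≤ ‖b‖ * (‖J‖ * ‖z‖) :=
          (b.le_opNorm _).trans (by gcongr; exact J.le_opNorm z)
      _ ≤ 1 / 4 * ‖z‖ := by rw [← mul_assoc]; gcongr
  have e2 : ‖μ • H z‖ ≤ 1 / 4 * ‖z‖ := by
    rw [norm_smul]
    calc ‖μ‖ * ‖H z‖ ≤ ‖μ‖ * ((‖v₀‖ + ‖H‖) * ‖z‖) := by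
          gcongr
          exact (H.le_opNorm z).trans (by gcongr; linarith [norm_nonneg v₀])
      _ ≤ 1 / 4 * ‖z‖ := by rw [← mul_assoc]; gcongr
  have e3 : ‖z‖ ≤ 1 / 4 * ‖z‖ + 1 / 4 * ‖z‖ := by
    conv_lhs => rw [hz1]
    exact (norm_sub_le _ _).trans (add_le_add e1 e2)
  have e4 : ‖z‖ ≤ 0 := by linarith [norm_nonneg z]
  rw [norm_le_zero_iff.1 e4, map_zero] at hxz
  exact hx0 hxz

/-- Small relatively bounded perturbations create no eigenvalues in a compact subset of the
resolvent set. -/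
theorem eventually_forall_eq_zero_of_isCompact [CompleteSpace E] (hμ₀ : μ₀ ∈ resolventSet A)
    {K : Set ℂ} (hK : IsCompact K) (hKA : K ⊆ resolventSet A) :
    ∀ᶠ b : E →L[ℂ] E in 𝓝 0, ∀ μ ∈ K, ∀ B : A.domain →ₗ[ℂ] E,
      (∀ x : A.domain, B x = b (μ₀ • (x : E) - A x)) →
      ∀ x : A.domain, A x + B x = μ • (x : E) → (x : E) = 0 := by
  have hR := isResolventAt_resolvent hμ₀
  set R := UnboundedOp.resolvent A μ₀
  -- The operator is (μ - A)R(μ₀, A), with inverse (μ₀ - A)R(μ, A).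
  have hunit : ∀ μ ∈ K, IsUnit (1 + (μ - μ₀) • R : E →L[ℂ] E) := by
    intro μ hμ
    have hQ := isResolventAt_resolvent (hKA hμ)
    set Q := UnboundedOp.resolvent A μ
    have h1 := hQ.resolvent_identity hR
    have h2 := hQ.resolvent_identity' hR
    refine ⟨⟨1 + (μ - μ₀) • R, 1 + (μ₀ - μ) • Q, ?_, ?_⟩, rfl⟩
    · rw [add_mul, mul_add, mul_add, smul_mul_smul_comm, one_mul, one_mul, mul_one]
      have h3 : (μ - μ₀) * (μ₀ - μ) = -(μ₀ - μ) * (μ₀ - μ) := by ring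
      rw [h3]
      linear_combination (norm := module) (μ₀ - μ) • h2
    · rw [add_mul, mul_add, mul_add, smul_mul_smul_comm, one_mul, one_mul, mul_one]
      have h3 : (μ₀ - μ) * (μ - μ₀) = -(μ₀ - μ) * (μ₀ - μ) := by ring
      rw [h3]
      linear_combination (norm := module) (μ₀ - μ) • h1
  -- Units form an open set, and compactness of K gives one neighbourhood of 0 for all μ.
  have hev : ∀ᶠ b : E →L[ℂ] E in 𝓝 0, ∀ μ ∈ K, IsUnit (1 + (μ - μ₀) • R - b) := by
    refine hK.eventually_forall_of_forall_eventually fun μ hμ => ?_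
    have hc : Continuous fun p : (E →L[ℂ] E) × ℂ => 1 + (p.2 - μ₀) • R - p.1 := by fun_prop
    refine hc.continuousAt.eventually (Units.isOpen.mem_nhds ?_)
    simpa using hunit μ hμ
  filter_upwards [hev] with b hbu μ hμ B hb x hx
  -- This operator applied to (μ₀ - A)x is (μ - A - B)x.
  have h1 : (1 + (μ - μ₀) • R - b) (μ₀ • (x : E) - A x) = 0 := by
    simp only [add_apply, sub_apply, smul_apply, one_apply_eq_self]
    rw [hR.left_inv, ← hb]
    linear_combination (norm := module) -hx
  obtain ⟨U, hU⟩ := hbu μ hμ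
  have h2 : μ₀ • (x : E) - A x = 0 := by
    have h3 : ((U⁻¹ : (E →L[ℂ] E)ˣ) * U : E →L[ℂ] E) (μ₀ • (x : E) - A x) = 0 := by
      rw [mul_apply_eq_comp, hU, h1, map_zero]
    rwa [Units.inv_mul] at h3
  rw [← hR.left_inv x, h2, map_zero]

/-- A graph-norm bounded operator, composed with the resolvent. -/
theorem exists_clm_comp_resolvent (hμ₀ : μ₀ ∈ resolventSet A)
    (hB : ∃ M : ℝ, ∀ x : A.domain, ‖B x‖ ≤ M * (‖(x : E)‖ + ‖A x‖)) :
    ∃ b : E →L[ℂ] E, ∀ x : A.domain, B x = b (μ₀ • (x : E) - A x) := by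
  obtain ⟨M, hM⟩ := hB
  have hR := isResolventAt_resolvent hμ₀
  set R := UnboundedOp.resolvent A μ₀
  let g : E →ₗ[ℂ] E := B.comp (R.toLinearMap.codRestrict A.domain hR.mem_domain)
  have hg : ∀ y, g y = B ⟨R y, hR.mem_domain y⟩ := fun _ => rfl
  refine ⟨g.mkContinuous (|M| * (‖R‖ + (‖μ₀‖ * ‖R‖ + 1))) fun y => ?_, fun x => ?_⟩
  · have h1 := hM ⟨R y, hR.mem_domain y⟩
    rw [hg]
    have h2 : ‖A ⟨R y, hR.mem_domain y⟩‖ ≤ (‖μ₀‖ * ‖R‖ + 1) * ‖y‖ := by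
      rw [hR.apply_eq]
      refine (norm_sub_le _ _).trans ?_
      rw [norm_smul, add_mul, one_mul, mul_assoc]
      gcongr
      exact R.le_opNorm y
    calc _ ≤ |M| * (‖R‖ * ‖y‖ + (‖μ₀‖ * ‖R‖ + 1) * ‖y‖) := by
          refine h1.trans ?_
          gcongr
          · exact le_abs_self M
          · exact R.le_opNorm y
      _ = _ := by ring
  · change B x = g _
    rw [hg]
    congr 1
    exact Subtype.ext (hR.left_inv x).symm

end UnboundedOp

/-! ### Conjugation symmetry and convergence in the gauge norm -/

namespace LatticeCplx

section Conj

variable {F : Type*} [AddCommGroup F]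

/-- Complex conjugation. -/
def conj (z : LatticeCplx F) : LatticeCplx F := ⟨z.re, -z.im⟩

theorem conj_add (z w : LatticeCplx F) : conj (z + w) = conj z + conj w := by
  ext <;> simp [conj, add_comm]

theorem conj_sub (z w : LatticeCplx F) : conj (z - w) = conj z - conj w := by
  ext <;> simp [conj, sub_eq_add_neg, add_comm]

theorem conj_eq_self {z : LatticeCplx F} (h : z.im = 0) : conj z = z := by
  ext <;> simp [conj, h]

variable [Module ℝ F]

theorem conj_smul (a : ℂ) (z : LatticeCplx F) :
    conj (a • z) = starRingEnd ℂ a • conj z := by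
  ext
  · simp [conj]
  · simp only [conj, smul_im, Complex.conj_re, Complex.conj_im]; module

theorem eq_ofReal_add (z : LatticeCplx F) : z = ofReal z.re + Complex.I • ofReal z.im := by
  ext <;> simp [ofReal]

theorem conj_eq_ofReal_sub (z : LatticeCplx F) :
    conj z = ofReal z.re - Complex.I • ofReal z.im := by
  ext <;> simp [ofReal, conj]

theorem IsRealOp.exists_apply_conj {A : LatticeCplx F →ₗ.[ℂ] LatticeCplx F} (hA : IsRealOp A)
    (z : A.domain) : ∃ h : conj (z : LatticeCplx F) ∈ A.domain, A ⟨conj z, h⟩ = conj (A z) := by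
  obtain ⟨hre, him⟩ := hA.1 z z.2
  set x : A.domain := ⟨_, hre⟩ with hx
  set y : A.domain := ⟨_, him⟩ with hy
  have hz : z = x + Complex.I • y := Subtype.ext (eq_ofReal_add _)
  have hc : conj (z : LatticeCplx F) = (x - Complex.I • y : A.domain) := conj_eq_ofReal_sub _
  have h : conj (z : LatticeCplx F) ∈ A.domain := hc ▸ Subtype.prop _
  have h1 : (⟨conj (z : LatticeCplx F), h⟩ : A.domain) = x - Complex.I • y := Subtype.ext hc
  refine ⟨h, ?_⟩
  rw [h1, hz, LinearPMap.map_sub, LinearPMap.map_add, LinearPMap.map_smul, conj_add, conj_smul,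
    conj_eq_self (hA.2 _ hre), conj_eq_self (hA.2 _ him), Complex.conj_I, neg_smul, sub_eq_add_neg]

end Conj

variable {F : Type*} [NormedAddCommGroup F] [Lattice F] [HasSolidNorm F] [IsOrderedAddMonoid F]
  [NormedSpace ℝ F] [IsOrderedModule ℝ F] [CompleteSpace F]

/-- Conjugate the decomposition x = φ(x)v₀ + (l - A)Hx. Since v₀, l and A are real, the result is
again a multiple of v₀ plus a vector in the range of l - A, on which φ vanishes. -/
theorem functional_conj {A : LatticeCplx F →ₗ.[ℂ] LatticeCplx F} (hA : IsRealOp A) {l : ℝ}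
    {v₀ : LatticeCplx F} (hv₀ : v₀.im = 0) {φ : LatticeCplx F →L[ℂ] ℂ}
    {H : LatticeCplx F →L[ℂ] LatticeCplx F}
    (hH : UnboundedOp.IsReducedResolvent A l v₀ φ H) (x : LatticeCplx F) :
    φ (conj x) = starRingEnd ℂ (φ x) := by
  obtain ⟨h, hc⟩ := hA.exists_apply_conj ⟨H x, hH.mem_domain x⟩
  have h1 : x = φ x • v₀ + ((l : ℂ) • H x - A ⟨H x, hH.mem_domain x⟩) := by
    rw [hH.apply_eq]; abel
  have h2 : conj x = starRingEnd ℂ (φ x) • v₀ + ((l : ℂ) • conj (H x) - A ⟨conj (H x), h⟩) := by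
    conv_lhs => rw [h1]
    rw [conj_add, conj_sub, conj_smul, conj_smul, conj_eq_self hv₀, Complex.conj_ofReal, ← hc]
  have h3 := hH.functional_range ⟨conj (H x), h⟩
  rw [h2, map_add, map_smul, hH.functional_eigenvector, h3, smul_eq_mul, mul_one, add_zero]

open MeasureTheory in
/-- Convergence of perturbed eigenvectors in the gauge norm of the principal ideal. -/
theorem eventually_modulus_eigenvector_sub_le {u : F} (hu : 0 ≤ u)
    {S : C0Semigroup (LatticeCplx F)} (hdiff : S.ImmediatelyDifferentiable)
    (hultra : Ultracontractive S u) {v w : ℂ → LatticeCplx F} {l : ℂ → ℂ}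
    (hv : ContinuousAt v 0) (hl : ContinuousAt l 0) {K : ℝ}
    (hgauge : ∀ᶠ κ in 𝓝 (0 : ℂ), ∀ t ∈ Ioc (0 : ℝ) 1,
      gaugeNorm u (S.T t (w κ)) ≤ K * t ^ (-(1 / 2) : ℝ))
    (heig : ∀ᶠ κ in 𝓝 (0 : ℂ), ∃ h : v κ ∈ S.generator.domain,
      S.generator ⟨v κ, h⟩ + w κ = l κ • v κ)
    (heig₀ : ∃ h : v 0 ∈ S.generator.domain, S.generator ⟨v 0, h⟩ = l 0 • v 0)
    {ε : ℝ} (hε : 0 < ε) :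
    ∀ᶠ κ in 𝓝 (0 : ℂ), (v κ - v 0).modulus ≤ ε • u := by
  obtain ⟨C, α, hC, -, hul⟩ := hultra
  obtain ⟨hd₀, hA₀⟩ := heig₀
  set Λ : ℝ := ‖l 0‖ + 1 with hΛ
  have hΛ0 : 0 ≤ Λ := by positivity
  -- The time t is fixed first, making the integral term at most (ε/2)u for all κ near 0; only then
  -- is κ taken small, so that the smoothing constant C t^{-α} is harmless.
  obtain ⟨t, ht, ht1, htK⟩ : ∃ t : ℝ, 0 < t ∧ t ≤ 1 ∧
      Real.exp Λ * K * (t ^ (1 / 2 : ℝ) / (1 / 2)) ≤ ε / 2 := by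
    have e1 : Tendsto (fun t : ℝ => Real.exp Λ * K * (t ^ (1 / 2 : ℝ) / (1 / 2))) (𝓝[>] 0)
        (𝓝 0) := by
      have h : Continuous fun t : ℝ => Real.exp Λ * K * (t ^ (1 / 2 : ℝ) / (1 / 2)) := by
        have := Real.continuous_rpow_const (show (0 : ℝ) ≤ 1 / 2 by norm_num)
        fun_prop
      have h2 := h.tendsto 0
      rw [Real.zero_rpow (by norm_num)] at h2
      simpa using h2.mono_left nhdsWithin_le_nhds
    have e2 : ∀ᶠ t : ℝ in 𝓝[>] 0, t ∈ Ioc (0 : ℝ) 1 := Ioc_mem_nhdsGT (by norm_num)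
    obtain ⟨t, h1, h2⟩ := ((e1.eventually_le_const (half_pos hε)).and e2).exists
    exact ⟨t, h2.1, h2.2, h1⟩
  let d : ℂ → LatticeCplx F := fun κ =>
    Complex.exp (-l κ * t) • v κ - Complex.exp (-l 0 * t) • v 0
  have hd : Tendsto (fun κ => C * t ^ (-α) * ‖d κ‖) (𝓝 0) (𝓝 0) := by
    have h1 : ContinuousAt d 0 := by fun_prop
    have h2 := h1.norm.tendsto.const_mul (C * t ^ (-α))
    simpa [d] using h2
  have hl' : ∀ᶠ κ in 𝓝 (0 : ℂ), ‖l κ‖ < Λ :=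
    hl.norm.tendsto.eventually_lt_const (by linarith)
  filter_upwards [hgauge, heig, hl', hd.eventually_le_const (half_pos hε)] with κ hg he hlκ hdκ
  obtain ⟨hdom, hA⟩ := he
  have h1 := C0Semigroup.eigenvector_eq_add_integral hdiff hdom hA ht
  have h0 := C0Semigroup.eigenvector_eq_add_integral hdiff (w := 0) hd₀
    (by rw [add_zero]; exact hA₀) ht
  simp only [map_zero, smul_zero, intervalIntegral.integral_zero, add_zero] at h0
  have h2 : v κ - v 0 = S.T t (d κ) +
      ∫ s in (0 : ℝ)..t, Complex.exp (-l κ * s) • S.T s (w κ) := by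
    simp only [d, map_sub, map_smul]
    linear_combination (norm := module) h1 - h0
  have h3 : (S.T t (d κ)).modulus ≤ (ε / 2) • u :=
    (modulus_le_gaugeNorm_smul hu (hul t ⟨ht, ht1⟩ _).1).trans
      (smul_le_smul_of_nonneg_right ((hul t ⟨ht, ht1⟩ _).2.trans hdκ) hu)
  have hint : IntervalIntegrable (fun s : ℝ => Complex.exp (-l κ * s) • S.T s (w κ)) volume 0 t := by
    have hexp : Continuous fun s : ℝ => Complex.exp (-l κ * s) := by fun_prop
    exact ContinuousOn.intervalIntegrable_of_Icc ht.le (hexp.continuousOn.smul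
      ((C0Semigroup.continuousOn_orbit hdiff (w κ)).mono Icc_subset_Ici_self))
  have h4 := modulus_intervalIntegral_le (u := u)
    (g := fun s => Real.exp Λ * K * s ^ (-(1 / 2) : ℝ)) ht.le hint
    ((intervalIntegral.intervalIntegrable_rpow' (by norm_num)).const_mul _) (fun s hs => by
      have hs1 : s ∈ Ioc (0 : ℝ) 1 := ⟨hs.1, hs.2.trans ht1⟩
      refine (modulus_smul_le_of_le _ (modulus_le_gaugeNorm_smul hu (hul s hs1 (w κ)).1)).trans
        (smul_le_smul_of_nonneg_right ?_ hu)
      rw [mul_assoc]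
      refine mul_le_mul ?_ (hg s hs1) (gaugeNorm_nonneg _ _) (Real.exp_pos _).le
      rw [Complex.norm_exp]
      gcongr
      refine (Complex.re_le_norm _).trans ?_
      rw [norm_mul, norm_neg, Complex.norm_real, Real.norm_of_nonneg hs.1.le]
      calc ‖l κ‖ * s ≤ Λ * 1 := mul_le_mul hlκ.le hs1.2 hs.1.le hΛ0
        _ = Λ := mul_one _)
  rw [intervalIntegral.integral_const_mul, integral_rpow (Or.inl (by norm_num)),
    show (-(1 / 2) + 1 : ℝ) = 1 / 2 by norm_num, Real.zero_rpow (by norm_num), sub_zero] at h4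
  have h5 := modulus_add_le_of_le h3 (h4.trans (smul_le_smul_of_nonneg_right htK hu))
  rwa [← h2, add_halves] at h5

end LatticeCplx

/-! ### The main theorem -/

theorem mainTheorem4
    {F : Type*} [NormedAddCommGroup F] [Lattice F] [HasSolidNorm F] [IsOrderedAddMonoid F]
    [NormedSpace ℝ F] [IsOrderedModule ℝ F] [CompleteSpace F]
    (u : F) (hu : 0 ≤ u)
    (S : C0Semigroup (LatticeCplx F))
    (hdiff : S.ImmediatelyDifferentiable)
    (B : ℂ → S.generator.domain →ₗ[ℂ] LatticeCplx F)
    (hB0 : B 0 = 0)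
    (hBbdd : ∀ κ ∈ Metric.ball (0 : ℂ) 1, S.GraphBounded (B κ))
    (hS1 : LatticeCplx.Ultracontractive S u)
    (hS2 : ∀ κ ∈ Metric.ball (0 : ℂ) 1, S.Admissible (B κ))
    (hS3 : ∀ κ ∈ Metric.ball (0 : ℂ) 1, LatticeCplx.IdealBounds S (B κ) u)
    (hhol : ∀ x : S.generator.domain,
      DifferentiableOn ℂ (fun κ => S.generator x + B κ x) (Metric.ball 0 1))
    (hAreal : LatticeCplx.IsRealOp S.generator)
    (hBreal : ∀ κ : ℝ, |κ| < 1 → LatticeCplx.IsRealOp (UnboundedOp.onDomain S.generator (B κ)))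
    (l₀ : ℝ)
    (hpole : UnboundedOp.IsPoleOfResolvent S.generator l₀)
    (hsimple : UnboundedOp.IsAlgSimple S.generator l₀)
    (v₀ : LatticeCplx F) (hv₀ : UnboundedOp.IsEigenvector S.generator l₀ v₀)
    (c : ℝ) (hc : 0 < c) (hv₀u : LatticeCplx.ofReal (c • u) ≤ v₀)
    (r : ℝ) (hr : 0 < r)
    (hisol : ∀ μ ∈ Set.Ioo (l₀ - r) (l₀ + r),
      ((μ : ℂ) ∈ UnboundedOp.spectrum S.generator ↔ μ = l₀))
    (hend : ∀ μ : ℝ, |μ - l₀| = r → (μ : ℂ) ∈ UnboundedOp.resolventSet S.generator)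
    (hβ : Filter.Tendsto (fun κ : ℝ => UnboundedOp.betaSup (B κ) l₀ r) (nhds 0) (nhds 0)) :
    ∃ δ : ℝ, 0 < δ ∧ δ ≤ 1 ∧ ∀ κ ∈ Set.Ioo (-δ) δ,
      ∃ l ∈ Set.Ioo (l₀ - r) (l₀ + r),
        UnboundedOp.IsAlgSimple (UnboundedOp.perturb S.generator (B κ)) l ∧
        (∀ μ ∈ Set.Ioo (l₀ - r) (l₀ + r),
          UnboundedOp.IsEigenvalue (UnboundedOp.perturb S.generator (B κ)) μ → μ = l) ∧
        ∃ v ∈ LatticeCplx.principalIdeal u,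
          UnboundedOp.IsEigenvector (UnboundedOp.perturb S.generator (B κ)) l v ∧
          LatticeCplx.ofReal ((c / 2) • u) ≤ v := by
  have hl₀r : |(l₀ + r) - l₀| = r := by rw [add_sub_cancel_left, abs_of_pos hr]
  set μ₀ : ℂ := ((l₀ + r : ℝ) : ℂ) with hμ₀def
  have hμ₀ : μ₀ ∈ UnboundedOp.resolventSet S.generator := hend _ hl₀r
  obtain ⟨φ, H, hH⟩ := UnboundedOp.exists_isReducedResolvent hμ₀ hpole hsimple hv₀
  have hv₀im : v₀.im = 0 := hv₀u.2.symm
  -- the perturbations as bounded operators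
  have hbex : ∀ κ : ℂ, ∃ b : LatticeCplx F →L[ℂ] LatticeCplx F, κ ∈ Metric.ball (0 : ℂ) 1 →
      ∀ x : S.generator.domain, B κ x = b (μ₀ • (x : LatticeCplx F) - S.generator x) := by
    intro κ
    by_cases hκ : κ ∈ Metric.ball (0 : ℂ) 1
    · obtain ⟨b, hb⟩ := UnboundedOp.exists_clm_comp_resolvent hμ₀ (hBbdd κ hκ)
      exact ⟨b, fun _ => hb⟩
    · exact ⟨0, fun h => absurd h hκ⟩
  choose b hb using hbex
  have hRes := UnboundedOp.isResolventAt_resolvent hμ₀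
  set R := UnboundedOp.resolvent S.generator μ₀
  have hbR : ∀ κ ∈ Metric.ball (0 : ℂ) 1, ∀ y, b κ y = B κ ⟨R y, hRes.mem_domain y⟩ := by
    intro κ hκ y
    rw [hb κ hκ, (hRes.1 y).2]
  have hbhol : ∀ y, DifferentiableOn ℂ (fun κ => b κ y) (Metric.ball 0 1) := by
    intro y
    refine ((hhol ⟨R y, hRes.mem_domain y⟩).sub_const
      (S.generator ⟨R y, hRes.mem_domain y⟩)).congr fun κ hκ => ?_
    rw [hbR κ hκ, add_sub_cancel_left]
  have hb0 : b 0 = 0 := by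
    ext1 y
    rw [hbR 0 (by simp), hB0]
    rfl
  obtain ⟨M, hM0, hM⟩ := exists_norm_le_mul_norm_of_strongly_holomorphic hbhol hb0
  -- the holomorphic branch of eigenvectors
  set J := UnboundedOp.reducedComp (l₀ : ℂ) μ₀ v₀ φ H with hJ
  set y₀ := (μ₀ - l₀) • v₀ with hy₀
  set Q := UnboundedOp.eigenConst φ H J v₀ y₀ with hQ
  have hQ0 : 0 ≤ Q := UnboundedOp.eigenConst_nonneg
  -- On the ρ-ball ‖b κ‖ ≤ Mρ, which makes the eigenvector map a contraction; the + 1 guards against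
  -- M Q = 0.
  obtain ⟨ρ, hρ, hρ2, hρQ⟩ : ∃ ρ : ℝ, 0 < ρ ∧ ρ ≤ 1 / 2 ∧ 4 * (M * ρ * Q) ≤ 1 := by
    refine ⟨min (1 / 2) (1 / (4 * (M * Q) + 1)), by positivity, min_le_left _ _, ?_⟩
    have h1 : min (1 / 2) (1 / (4 * (M * Q) + 1)) ≤ 1 / (4 * (M * Q) + 1) := min_le_right _ _
    have h2 : 0 ≤ M * Q := by positivity
    calc 4 * (M * min (1 / 2) (1 / (4 * (M * Q) + 1)) * Q)
        = 4 * (M * Q) * min (1 / 2) (1 / (4 * (M * Q) + 1)) := by ring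
      _ ≤ 4 * (M * Q) * (1 / (4 * (M * Q) + 1)) := by gcongr
      _ ≤ 1 := by rw [mul_one_div, div_le_one (by positivity)]; linarith
  have hball1 : ∀ κ ∈ Metric.ball (0 : ℂ) ρ, κ ∈ Metric.ball (0 : ℂ) 1 := fun κ hκ =>
    Metric.ball_subset_ball (by linarith) hκ
  have hbn : ∀ κ ∈ Metric.ball (0 : ℂ) ρ, ‖b κ‖ ≤ M * ρ := by
    intro κ hκ
    refine (hM κ (Metric.ball_subset_ball hρ2 hκ)).trans ?_
    gcongr
    exact (mem_ball_zero_iff.1 hκ).le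
  have hsmall : ∀ κ ∈ Metric.ball (0 : ℂ) ρ, 4 * (‖b κ‖ * Q) ≤ 1 := by
    intro κ hκ
    refine le_trans ?_ hρQ
    gcongr
    exact hbn κ hκ
  have hprod : ∀ z : ℂ → LatticeCplx F, DifferentiableOn ℂ z (Metric.ball 0 ρ) →
      DifferentiableOn ℂ (fun κ => b κ (y₀ + J (z κ))) (Metric.ball 0 ρ) := fun z hz =>
    differentiableOn_clm_apply_of_strongly_holomorphic
      (fun y => (hbhol y).mono fun κ hκ => hball1 κ hκ) hbn
      ((J.differentiable.comp_differentiableOn hz).const_add y₀)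
  obtain ⟨z, hzd, hz⟩ := exists_holomorphic_fixedPoint
    (Φ := fun κ => UnboundedOp.eigenMap φ H J v₀ y₀ (b κ)) (ρ := ρ)
    (fun κ hκ x hx => UnboundedOp.norm_eigenMap_le (hsmall κ hκ) hx)
    (fun κ hκ x w hx hw => UnboundedOp.norm_eigenMap_sub_le (hsmall κ hκ) hx hw)
    (fun x hx => by
      have h1 := hprod x hx
      exact h1.sub ((φ.differentiable.comp_differentiableOn h1).smul
        ((H.differentiable.comp_differentiableOn hx).const_add v₀)))
  have hz0 : z 0 = 0 := by
    have h1 := (hz 0 (Metric.mem_ball_self hρ)).2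
    rw [← h1]
    simp [UnboundedOp.eigenMap, hb0]
  set v : ℂ → LatticeCplx F := fun κ => v₀ + H (z κ) with hvdef
  set w : ℂ → LatticeCplx F := fun κ => b κ (y₀ + J (z κ)) with hwdef
  have hwd : DifferentiableOn ℂ w (Metric.ball 0 ρ) := hprod z hzd
  have hv0 : v 0 = v₀ := by simp [hvdef, hz0]
  have hw0 : w 0 = 0 := by simp [hwdef, hb0]
  have hnhds : Metric.ball (0 : ℂ) ρ ∈ 𝓝 0 := Metric.ball_mem_nhds 0 hρ
  have hvc : ContinuousAt v 0 :=
    continuousAt_const.add (H.continuous.continuousAt.comp (hzd.continuousOn.continuousAt hnhds))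
  have hwc : ContinuousAt w 0 := hwd.continuousOn.continuousAt hnhds
  have heig : ∀ κ ∈ Metric.ball (0 : ℂ) ρ, φ (v κ) = 1 ∧ ∃ h : v κ ∈ S.generator.domain,
      B κ ⟨v κ, h⟩ = w κ ∧
      S.generator ⟨v κ, h⟩ + B κ ⟨v κ, h⟩ = ((l₀ : ℂ) + φ (w κ)) • v κ := fun κ hκ =>
    hH.eigenvector_of_fixedPoint hv₀ (hb κ (hball1 κ hκ)) (hz κ hκ).2
  have hwmem : ∀ κ ∈ Metric.ball (0 : ℂ) ρ, w κ ∈ LatticeCplx.principalIdeal u := by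
    intro κ hκ
    obtain ⟨-, h, hBv, hAB⟩ := heig κ hκ
    have hκ1 := hball1 κ hκ
    rw [← hBv]
    exact LatticeCplx.perturbation_eigenvector_mem_principalIdeal hu hdiff hS1 (hS2 κ hκ1)
      (hS3 κ hκ1) (hb κ hκ1) h hAB
  -- convergence of the eigenvectors in the principal ideal
  obtain ⟨C, _, -, -, -, hC⟩ := hS3 0 (by simp)
  obtain ⟨ρ', hρ', K, hK⟩ := LatticeCplx.exists_gaugeNorm_le_rpow hu hS1
    (fun t ht x hx => (hC t ht x hx).1.2) hρ hwd hwmem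
  have hlc : ContinuousAt (fun κ => (l₀ : ℂ) + φ (w κ)) 0 :=
    continuousAt_const.add (φ.continuous.continuousAt.comp hwc)
  have hclose := LatticeCplx.eventually_modulus_eigenvector_sub_le hu hdiff hS1 hvc hlc
    (Filter.mem_of_superset (Metric.ball_mem_nhds 0 hρ') fun κ hκ => hK κ hκ)
    (Filter.mem_of_superset hnhds fun κ hκ => by
      obtain ⟨-, h, hBv, hAB⟩ := heig κ hκ
      exact ⟨h, (congrArg (S.generator ⟨v κ, h⟩ + ·) hBv.symm).trans hAB⟩)
    (by
      rw [hv0, hw0, map_zero, add_zero]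
      exact hv₀.2) (half_pos hc)
  -- absence of eigenvalues away from `l₀`
  obtain ⟨ε, hε, hεH⟩ : ∃ ε : ℝ, 0 < ε ∧ ε * (‖v₀‖ + ‖H‖) ≤ 1 / 4 := by
    refine ⟨1 / (4 * (‖v₀‖ + ‖H‖) + 1), by positivity, ?_⟩
    rw [one_div_mul_eq_div, div_le_div_iff₀ (by positivity) (by norm_num)]
    linarith
  let Z : Set ℂ := (fun x : ℝ => (x : ℂ)) '' {x : ℝ | x ∈ Icc (l₀ - r) (l₀ + r) ∧ ε ≤ |x - l₀|}
  have hZc : IsCompact Z := by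
    refine IsCompact.image ?_ Complex.continuous_ofReal
    exact isCompact_Icc.inter_right (isClosed_le continuous_const
      (continuous_id.sub continuous_const).abs)
  have hZA : Z ⊆ UnboundedOp.resolventSet S.generator := by
    rintro _ ⟨x, ⟨hx, hxε⟩, rfl⟩
    rcases (abs_le.2 ⟨by linarith [hx.1], by linarith [hx.2]⟩ : |x - l₀| ≤ r).eq_or_lt with h | h
    · exact hend x h
    · by_contra hcon
      have h1 : x = l₀ :=
        (hisol x ⟨by linarith [(abs_lt.1 h).1], by linarith [(abs_lt.1 h).2]⟩).1 hcon
      rw [h1, sub_self, abs_zero] at hxε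
      linarith
  have hbtend : Tendsto b (𝓝 0) (𝓝 0) := by
    refine squeeze_zero_norm' (a := fun κ => M * ‖κ‖) ?_ ?_
    · exact Filter.mem_of_superset (Metric.ball_mem_nhds 0 (by norm_num)) hM
    · have : Continuous fun κ : ℂ => M * ‖κ‖ := by fun_prop
      simpa using this.tendsto 0
  have hfar := hbtend.eventually (UnboundedOp.eventually_forall_eq_zero_of_isCompact hμ₀ hZc hZA)
  have hμsmall : ∀ᶠ κ in 𝓝 (0 : ℂ), ‖φ (w κ)‖ < r := by
    have h1 : ContinuousAt (fun κ => ‖φ (w κ)‖) 0 := (φ.continuous.continuousAt.comp hwc).norm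
    refine h1.tendsto.eventually_lt_const ?_
    rw [hw0]; simpa using hr
  obtain ⟨δ₀, hδ₀, hδ⟩ := Metric.eventually_nhds_iff_ball.1
    (hclose.and (hfar.and (hμsmall.and hnhds)))
  refine ⟨min δ₀ 1, by positivity, min_le_right _ _, fun κ hκ => ?_⟩
  have hκabs : |κ| < min δ₀ 1 := abs_lt.2 hκ
  have hκδ : (κ : ℂ) ∈ Metric.ball (0 : ℂ) δ₀ := by
    rw [mem_ball_zero_iff, Complex.norm_real]
    exact hκabs.trans_le (min_le_left _ _)
  obtain ⟨hcl, hfa, hμr, hκρ⟩ := hδ κ hκδ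
  have hκ1 := hball1 _ hκρ
  obtain ⟨hφv, hvdom, hBv, hAB⟩ := heig κ hκρ
  set μ := φ (w κ) with hμ
  have hz1 := (hz κ hκρ).1
  have hμH : ‖μ‖ * (‖v₀‖ + ‖H‖) ≤ 1 / 4 :=
    UnboundedOp.norm_functional_mul_le (hsmall κ hκρ) hz1
  -- uniqueness of normalised eigenpairs near `l₀`
  have huniq : ∀ (ν : ℂ) (x : LatticeCplx F) (hx : x ∈ S.generator.domain),
      ‖ν‖ * (‖v₀‖ + ‖H‖) ≤ 1 / 4 → φ x = 1 →
      S.generator ⟨x, hx⟩ + B κ ⟨x, hx⟩ = ((l₀ : ℂ) + ν) • x → x = v κ ∧ ν = μ := by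
    intro ν x hx hν hφx hABx
    obtain ⟨z', hz'1, hz'f, hxz', hνz'⟩ := hH.fixedPoint_of_eigenvector hv₀ (hb κ hκ1)
      (hsmall κ hκρ) hν hφx hx hABx
    have hzz : z' = z κ := UnboundedOp.eigenMap_fixedPoint_unique (hsmall κ hκρ) hz'1 hz1 hz'f
      (hz κ hκρ).2
    subst hzz
    exact ⟨hxz', hνz'⟩
  -- For real κ the conjugate of the eigenpair is again a normalised eigenpair, hence equal to it by
  -- uniqueness.
  obtain ⟨hconj, hμconj⟩ : LatticeCplx.conj (v κ) = v κ ∧ starRingEnd ℂ μ = μ := by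
    obtain ⟨h1, h2⟩ := hAreal.exists_apply_conj ⟨v κ, hvdom⟩
    obtain ⟨h3, h4⟩ := (hBreal κ (hκabs.trans_le (min_le_right _ _))).exists_apply_conj
      ⟨v κ, hvdom⟩
    refine huniq _ _ h1 (by rwa [RCLike.norm_conj]) ?_ ?_
    · rw [LatticeCplx.functional_conj hAreal hv₀im hH, hφv, map_one]
    · have h5 : B κ ⟨LatticeCplx.conj (v κ), h1⟩ = LatticeCplx.conj (B κ ⟨v κ, hvdom⟩) := h4
      rw [h2, h5, ← LatticeCplx.conj_add, hAB, LatticeCplx.conj_smul, map_add, Complex.conj_ofReal]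
  have hμre : (μ.re : ℂ) = μ := Complex.conj_eq_iff_re.1 hμconj
  have hlμ : ((l₀ + μ.re : ℝ) : ℂ) = (l₀ : ℂ) + μ := by push_cast; rw [hμre]
  have hvim : (v κ).im = 0 := by
    have h1 : -(v κ).im = (v κ).im := congrArg LatticeCplx.im hconj
    have h2 : (2 : ℝ) • (v κ).im = 0 := by
      rw [two_smul]
      nth_rewrite 1 [← h1]
      exact neg_add_cancel _
    exact (smul_eq_zero.1 h2).resolve_left two_ne_zero
  have hre : |μ.re| < r := (Complex.abs_re_le_norm μ).trans_lt hμr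
  have hvne : v κ ≠ 0 := by
    intro h
    rw [h, map_zero] at hφv
    exact zero_ne_one hφv
  refine ⟨l₀ + μ.re, ⟨by linarith [(abs_lt.1 hre).1], by linarith [(abs_lt.1 hre).2]⟩, ?_, ?_,
    v κ, ?_, ?_, ?_⟩
  · rw [hlμ]
    exact hH.isAlgSimple_perturb hv₀ (hb κ hκ1) (hsmall κ hκρ) hμH hφv hvdom hAB
      (UnboundedOp.norm_add_apply_le H v₀ hz1)
  · rintro ν hν ⟨x, hx0, hxd', hABx'⟩
    have hxd : x ∈ S.generator.domain := hxd'
    have hABx : S.generator ⟨x, hxd⟩ + B κ ⟨x, hxd⟩ = (ν : ℂ) • x := hABx'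
    by_cases hεν : ε ≤ |ν - l₀|
    · exact absurd (hfa ν ⟨ν, ⟨Ioo_subset_Icc_self hν, hεν⟩, rfl⟩ (B κ) (hb κ hκ1) ⟨x, hxd⟩ hABx) hx0
    · push Not at hεν
      set τ : ℂ := ((ν - l₀ : ℝ) : ℂ) with hτ
      have hντ : (ν : ℂ) = (l₀ : ℂ) + τ := by rw [hτ]; push_cast; ring
      have hτH : ‖τ‖ * (‖v₀‖ + ‖H‖) ≤ 1 / 4 := by
        refine le_trans ?_ hεH
        gcongr
        rw [hτ, Complex.norm_real]
        exact hεν.le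
      rw [hντ] at hABx
      have hφx := hH.functional_ne_zero hv₀ (hb κ hκ1) (hsmall κ hκρ) hτH hxd hABx hx0
      have h1 := huniq τ ((φ x)⁻¹ • x) (S.generator.domain.smul_mem _ hxd) hτH
        (by rw [map_smul, smul_eq_mul, inv_mul_cancel₀ hφx]) (by
          have h2 : (⟨(φ x)⁻¹ • x, S.generator.domain.smul_mem _ hxd⟩ : S.generator.domain) =
            (φ x)⁻¹ • ⟨x, hxd⟩ := rfl
          rw [h2, LinearPMap.map_smul, map_smul, ← smul_add, hABx, smul_comm])
      have h3 : τ.re = μ.re := congrArg Complex.re h1.2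
      rw [hτ, Complex.ofReal_re] at h3
      linarith
  -- v₀ = e^{-l₀} T(1)v₀ lies in E_u by ultracontractivity, and v(κ) - v₀ lies in E_u by the
  -- closeness estimate.
  · have h2 : v₀ ∈ LatticeCplx.principalIdeal u := by
      obtain ⟨Cu, α, -, -, hul⟩ := hS1
      have h3 := C0Semigroup.eigenvector_eq_add_integral hdiff (w := 0) hv₀.2.choose
        (by rw [add_zero]; exact hv₀.2.choose_spec) one_pos
      simp only [map_zero, smul_zero, intervalIntegral.integral_zero, add_zero] at h3
      obtain ⟨a, -, ha⟩ := (hul 1 ⟨one_pos, le_rfl⟩ v₀).1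
      rw [h3]
      exact LatticeCplx.mem_principalIdeal_of_le hu (LatticeCplx.modulus_smul_le_of_le _ ha)
    obtain ⟨a, -, ha⟩ := h2
    rw [hv0] at hcl
    have h4 := LatticeCplx.modulus_add_le_of_le hcl ha
    rw [sub_add_cancel] at h4
    exact LatticeCplx.mem_principalIdeal_of_le hu h4
  · refine ⟨hvne, hvdom, ?_⟩
    rw [UnboundedOp.perturb_apply, hAB, hlμ]
  -- Closeness was requested with constant c/2, so v(κ) ≥ v₀ - (c/2)u ≥ (c/2)u.
  · refine ⟨?_, by rw [hvim]; rfl⟩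
    rw [hv0] at hcl
    have h1 := (neg_le_abs _).trans ((LatticeCplx.abs_re_le (v κ - v₀)).trans hcl)
    have h2 : c • u ≤ v₀.re := hv₀u.1
    rw [LatticeCplx.sub_re, neg_sub, sub_le_iff_le_add] at h1
    change (c / 2) • u ≤ (v κ).re
    have h3 : c • u = (c / 2) • u + (c / 2) • u := by rw [← add_smul, add_halves]
    have h4 := h2.trans h1
    rw [h3] at h4
    exact le_of_add_le_add_left h4
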